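/- Let $\mathcal B$ be an oriented finite 2-dimensional CW complex with at least one edge: a finite directed graph $\mathcal B^{(1)}$ (the 1-skeleton) with vertex set $\mathcal B^0$, edge set $\mathcal B^1$ and source and range maps $s,r$, together with a finite set $\mathcal B^2$ of faces and, for each face $\sigma$, a closed sequence of edges $\nu(\sigma)=(e_1,\dots,e_n)$, given up to cyclic permutation, with $r(e_i)=s(e_{i+1})$ for $i\in\mathbb Z/n$. The boundary graph $\mathcal B_\partial$ has vertex set $\mathcal B^1$ and one edge $(\sigma,e)$, from $e$ to the edge $e'$ that follows it, for each appearance of an edge $e$ in some $\nu(\sigma)$. For a finite graph $G$ let $C^*(G)$ be the universal $C^*$-algebra generated by mutually orthogonal projections $P_v$ and partial isometries $S_e$ with $S_e^*S_e=P_{r(e)}$ for every edge $e$, and $P_v=\sum_{s(e)=v}S_eS_e^*$ for every vertex $v$ that is not a sink. Let $C^*(\mathcal B)=C^*(\mathcal B^{(1)})\otimes C^*(\mathcal B_\partial)$, with generators $P_v,S_e$ from the first factor and $P_e,S_{\sigma,e}$ from the second. Let $\mathcal M_{\mathcal B}\subset C^*(\mathcal B)$ be the linear span of the elements $S_\mu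 S_\nu^*S_\Omega S_\Lambda^*$, where $\mu,\nu$ are oriented paths in $\mathcal B^{(1)}$ with $r(\mu)=r(\nu)$, $\Omega,\Lambda$ are oriented paths in $\mathcal B_\partial$ with $r(\Omega)=r(\Lambda)$, and paths of length zero are allowed, with $S_v=P_v$. The gauge action of $U(1)\times U(1)$ is given by $S_e\mapsto zS_e$, $S_{\sigma,e}\mapsto wS_{\sigma,e}$, with all projections $P_v,P_e$ fixed. A rank 2 graph weight is a quadruple of nonnegative real functions $(g,\tilde\lambda,\lambda,\eta)$ on $\mathcal B^0,\mathcal B^1,\mathcal B^1,\mathcal B^2$ such that $g(v)=\sum_{s(e)=v}\tilde\lambda(e)g(r(e))$ for every vertex $v$ that is not a sink of $\mathcal B^{(1)}$, and $\lambda(e)=\sum\eta(\sigma)\lambda(e')$ for every $e$ that is not a sink of $\mathcal B_\partial$, the sum being over all appearances of $e$ in boundaries $\nu(\sigma)$, with $e'$ the edge following that appearance. It is faithful if the four functions vanish nowhere. A weight on $\mathcal M_{\mathcal B}$ is a linear functional $\psi:\mathcal M_{\mathcal B}\to\mathbb C$ with $\psi(x^*x)\ge 0$ for all $x\in\mathcal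 M_{\mathcal B}$; it is faithful if $\psi(x^*x)=0$ implies $x=0$. A KMS weight for a time evolution $\sigma_t$ on a $C^*$-algebra is a proper (nonzero, densely defined, lower semicontinuous) $\sigma$-invariant weight $\Psi$ such that for all $x,y\in\mathcal N_\Psi\cap\mathcal N_\Psi^*$, where $\mathcal N_\Psi=\{x:\Psi(x^*x)<\infty\}$, there is a bounded continuous function $F$ on $\{0\le\operatorname{Im}z\le1\}$, analytic in the interior, with $F(t)=\Psi(\sigma_t(x)y)$ and $F(t+i)=\Psi(y\sigma_t(x))$ for all $t\in\mathbb R$. Then $\mathcal M_{\mathcal B}$ is dense in $C^*(\mathcal B)$, and the following hold. (1) Let $(g,\tilde\lambda,\lambda,\eta)$ be a faithful rank 2 graph weight on $\mathcal B$. There is a unique linear functional $\psi$ on $\mathcal M_{\mathcal B}$ with $$\psi(S_\mu S_\nu^*S_\Omega S_\Lambda^*)=\delta_{\mu,\nu}\,\delta_{\Omega,\Lambda}\;\tilde\lambda(e_1)\cdots\tilde\lambda(e_n)\,g(r(\mu))\;\eta(\sigma_1)\cdots\eta(\sigma_m)\,\lambda(r(\Omega))$$ whenever $\mu=e_1\cdots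 e_n$ and $\Omega=(\sigma_1,a_1)\cdots(\sigma_m,a_m)$, where $n,m\ge0$. It is a gauge invariant weight on $\mathcal M_{\mathcal B}$. Moreover there is a time evolution $\sigma_t$ on $C^*(\mathcal B)$ that fixes all $P_v$ and $P_e$ and satisfies $\sigma_t(S_e)=\tilde\lambda(e)^{it}S_e$ and $\sigma_t(S_{\sigma,e})=\eta(\sigma)^{it}S_{\sigma,e}$, and $\psi$ is the restriction to $\mathcal M_{\mathcal B}$ of (the linear extension of) a gauge invariant KMS weight on $C^*(\mathcal B)$ for $\sigma_t$. (2) Conversely, let $\psi$ be a faithful gauge invariant weight on $\mathcal M_{\mathcal B}$ such that the ratio $\psi(S_{\sigma,e}S_{\sigma,e}^*)/\psi(S_{\sigma,e}^*S_{\sigma,e})=\psi(S_{\sigma,e}S_{\sigma,e}^*)/\psi(P_{e'})$, where $e'$ follows $e$ in $\nu(\sigma)$, depends only on $\sigma$ and not on the chosen appearance of an edge $e$ in $\nu(\sigma)$. Then $$g(v)=\psi(P_v),\quad \tilde\lambda(e)=\frac{\psi(S_eS_e^*)}{\psi(S_e^*S_e)},\quad \lambda(e)=\psi(P_e),\quad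 \eta(\sigma)=\frac{\psi(S_{\sigma,e}S_{\sigma,e}^*)}{\psi(S_{\sigma,e}^*S_{\sigma,e})}$$ (with an arbitrary positive value of $\eta(\sigma)$ if $\nu(\sigma)$ is empty) define a faithful rank 2 graph weight on $\mathcal B$. -/

import Mathlib

open scoped ENNReal NNReal ComplexOrder

noncomputable section

namespace CWKMS

/-! ### Directed graphs, paths, graph weights -/

/-- A directed graph with vertices `V`, edges `E` (loops and multiple edges allowed), source map `s`
and range map `r`. -/
structure DirGraph (V E : Type*) where
  s : E → V
  r : E → V

namespace DirGraph

variable {V E : Type*} (G : DirGraph V E)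

/-- `v` is a sink: no edge starts at `v`. -/
def IsSink (v : V) : Prop := ∀ e, G.s e ≠ v

/-- The list of edges `l` is an oriented path from `v` to `w`. -/
def IsPath : V → List E → V → Prop
  | v, [], w => v = w
  | v, e :: l, w => G.s e = v ∧ IsPath (G.r e) l w

/-- Oriented paths of length `≥ 0` (a path of length zero is a vertex). -/
@[ext]
structure Path where
  src : V
  edges : List E
  tgt : V
  isPath : G.IsPath src edges tgt

/-- The path of length zero at `v`. -/
def Path.nil (v : V) : G.Path := ⟨v, [], v, rfl⟩

/-- The path of length one given by the edge `e`. -/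
def Path.single (e : E) : G.Path := ⟨G.s e, [e], G.r e, rfl, rfl⟩

open Classical in
/-- Graph weights: pairs of nonnegative functions `g` on vertices, `lam` on edges, with
`g v = ∑_{s e = v} lam e * g (r e)` at every vertex `v` that is not a sink. -/
def IsGraphWeight [Fintype E] (g : V → ℝ) (lam : E → ℝ) : Prop :=
  (∀ v, 0 ≤ g v) ∧ (∀ e, 0 ≤ lam e) ∧
    ∀ v, ¬ G.IsSink v → g v = ∑ e with G.s e = v, lam e * g (G.r e)

open Classical in
/-- Cuntz-Krieger families of a finite directed graph in a unital star ring: mutually orthogonal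
projections `P v` with sum `1` and elements `S e` with `(S e)* S e = P (r e)`, and
`P v = ∑_{s e = v} S e (S e)*` at every vertex that is not a sink. -/
structure CKFamily [Fintype V] [Fintype E] (D : Type*) [Ring D] [StarRing D] where
  P : V → D
  S : E → D
  proj : ∀ v, IsStarProjection (P v)
  orth : ∀ v w, v ≠ w → P v * P w = 0
  sum_proj : ∑ v, P v = 1
  star_mul : ∀ e, star (S e) * S e = P (G.r e)
  ck : ∀ v, ¬ G.IsSink v → P v = ∑ e with G.s e = v, S e * star (S e)

end DirGraph

/-! ### Families of operators and the C*-algebras generated by them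

A separable C*-algebra is determined by its representations on `ℓ²(ℕ)`. The universal C*-algebras
below are all separable, so they can be realized inside the C*-algebra of bounded families of
operators on `ℓ²(ℕ)`, indexed by all representations of the relations in question. -/

/-- Bounded operators on `ℓ²(ℕ)`. -/
abbrev Op : Type := lp (fun _ : ℕ => ℂ) 2 →L[ℂ] lp (fun _ : ℕ => ℂ) 2

instance : Nontrivial (lp (fun _ : ℕ => ℂ) 2) :=
  ⟨lp.single 2 0 1, 0, fun h => by
    have := congrArg (fun x : lp (fun _ : ℕ => ℂ) 2 => x 0) h
    simp at this⟩

/-- Bounded families of operators on `ℓ²(ℕ)`, with the supremum norm. -/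
abbrev Fam (I : Type*) : Type _ := lp (fun _ : I => Op) ∞

instance (I : Type*) : CStarAlgebra (Fam I) where

/-- Re-indexing of families. -/
def pullback {I J : Type*} (f : I → J) : Fam J →⋆ₐ[ℂ] Fam I where
  toFun x := ⟨fun i => x (f i), memℓp_infty ⟨‖x‖, by
    rintro _ ⟨i, rfl⟩
    exact lp.norm_apply_le_norm (by simp) x (f i)⟩⟩
  map_one' := rfl
  map_mul' _ _ := rfl
  map_zero' := rfl
  map_add' _ _ := rfl
  commutes' _ := rfl
  map_star' _ := rfl

theorem continuous_pullback {I J : Type*} (f : I → J) : Continuous (pullback f) :=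
  AddMonoidHomClass.continuous_of_bound (pullback f) 1 fun x => by
    rw [one_mul]
    exact lp.norm_le_of_forall_le (norm_nonneg x) fun i => lp.norm_apply_le_norm (by simp) x (f i)

/-- The C*-subalgebra of `Fam I` generated by a set `G`. -/
def Gen {I : Type*} (G : Set (Fam I)) : StarSubalgebra ℂ (Fam I) :=
  (StarAlgebra.adjoin ℂ G).topologicalClosure

instance {I : Type*} (G : Set (Fam I)) : IsClosed (Gen G : Set (Fam I)) :=
  StarSubalgebra.isClosed_topologicalClosure _

theorem subset_gen {I : Type*} {G : Set (Fam I)} {x : Fam I} (hx : x ∈ G) : x ∈ Gen G :=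
  StarSubalgebra.le_topologicalClosure _ (StarAlgebra.subset_adjoin ℂ G hx)

theorem pullback_mem {I J : Type*} (f : I → J) {G : Set (Fam J)} {G' : Set (Fam I)}
    (h : ∀ x ∈ G, pullback f x ∈ Gen G') (x : Fam J) (hx : x ∈ Gen G) :
    pullback f x ∈ Gen G' := by
  have h1 : StarAlgebra.adjoin ℂ G ≤ (Gen G').comap (pullback f) :=
    StarAlgebra.adjoin_le fun y hy => h y hy
  have hc : IsClosed (((Gen G').comap (pullback f) : StarSubalgebra ℂ (Fam J)) : Set (Fam J)) :=
    (StarSubalgebra.isClosed_topologicalClosure _).preimage (continuous_pullback f)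
  exact StarSubalgebra.topologicalClosure_minimal h1 hc hx

/-- Re-indexing, restricted to generated C*-subalgebras. -/
def genMap {I J : Type*} (f : I → J) {G : Set (Fam J)} {G' : Set (Fam I)}
    (h : ∀ x ∈ G, pullback f x ∈ Gen G') : Gen G →⋆ₐ[ℂ] Gen G' :=
  ((pullback f).comp (Gen G).subtype).codRestrict (Gen G') fun x => pullback_mem f h x x.2

/-! ### Graph C*-algebras -/

section GraphCStar

variable {V E : Type*} [Fintype V] [Fintype E] (G : DirGraph V E)

theorem norm_proj_le {p : Op} (hp : IsStarProjection p) : ‖p‖ ≤ 1 := by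
  have h : ‖p‖ * ‖p‖ = ‖p‖ := by
    have := CStarRing.norm_star_mul_self (x := p)
    rw [hp.isSelfAdjoint.star_eq, hp.isIdempotentElem.eq] at this
    exact this.symm
  nlinarith [norm_nonneg p]

/-- The universal family of projections. -/
def univP (v : V) : Fam (G.CKFamily Op) :=
  ⟨fun i => i.P v, memℓp_infty ⟨1, by rintro _ ⟨i, rfl⟩; exact norm_proj_le (i.proj v)⟩⟩

/-- The universal family of partial isometries. -/
def univS (e : E) : Fam (G.CKFamily Op) :=
  ⟨fun i => i.S e, memℓp_infty ⟨1, by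
    rintro _ ⟨i, rfl⟩
    have h := CStarRing.norm_star_mul_self (x := i.S e)
    rw [i.star_mul] at h
    have := norm_proj_le (i.proj (G.r e))
    dsimp only
    nlinarith [norm_nonneg (i.S e)]⟩⟩

/-- The graph C*-algebra `C*(G)` of a finite graph: the universal C*-algebra generated by a
Cuntz-Krieger family, that is, the C*-algebra generated by the direct sum of all Cuntz-Krieger
families of operators on `ℓ²(ℕ)`. -/
def GraphCStar : Type _ := Gen (Set.range (univP G) ∪ Set.range (univS G))

instance : CStarAlgebra (GraphCStar G) :=
  inferInstanceAs (CStarAlgebra (Gen (Set.range (univP G) ∪ Set.range (univS G))))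

namespace GraphCStar

/-- The canonical projection `P_v`. -/
def P (v : V) : GraphCStar G := ⟨univP G v, subset_gen (Or.inl ⟨v, rfl⟩)⟩

/-- The canonical partial isometry `S_e`. -/
def S (e : E) : GraphCStar G := ⟨univS G e, subset_gen (Or.inr ⟨e, rfl⟩)⟩

/-- `S_μ = S_{e₁} ⋯ S_{eₙ}` for a path `μ = e₁ ⋯ eₙ`, and `S_v = P_v` for a path of length zero. -/
def Spath (μ : G.Path) : GraphCStar G := P G μ.src * (μ.edges.map (S G)).prod

theorem proj (v : V) : IsStarProjection (P G v) where
  isIdempotentElem := Subtype.ext <| Subtype.ext <| funext fun i => (i.proj v).isIdempotentElem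
  isSelfAdjoint := Subtype.ext <| Subtype.ext <| funext fun i => (i.proj v).isSelfAdjoint

theorem star_mul (e : E) : star (S G e) * S G e = P G (G.r e) :=
  Subtype.ext <| Subtype.ext <| funext fun i => i.star_mul e

theorem ext_family {x y : GraphCStar G} (h : ∀ i : G.CKFamily Op, x.1 i = y.1 i) : x = y :=
  Subtype.ext <| Subtype.ext <| funext h

theorem sum_apply {ι : Type*} (s : Finset ι) (x : ι → GraphCStar G) (i : G.CKFamily Op) :
    (∑ j ∈ s, x j : GraphCStar G).1 i = ∑ j ∈ s, (x j).1 i := by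
  classical
  induction s using Finset.induction_on with
  | empty => simp; rfl
  | insert a s ha ih => rw [Finset.sum_insert ha, Finset.sum_insert ha, ← ih]; rfl

theorem sum_proj : ∑ v, P G v = 1 :=
  ext_family G fun i => (sum_apply G _ _ i).trans i.sum_proj

open Classical in
theorem ck (v : V) (hv : ¬ G.IsSink v) :
    P G v = ∑ e with G.s e = v, S G e * star (S G e) :=
  ext_family G fun i => (i.ck v hv).trans
    (sum_apply G _ (fun e => S G e * star (S G e)) i).symm

theorem P_mul_S (e : E) : P G (G.s e) * S G e = S G e := by
  classical
  let _ := CStarAlgebra.spectralOrder (GraphCStar G)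
  let _ := CStarAlgebra.spectralOrderedRing (GraphCStar G)
  set p := P G (G.s e) with hp
  have hpp : p * p = p := (proj G _).isIdempotentElem
  have hps : star p = p := (proj G _).isSelfAdjoint
  have h0 : ∑ f with G.s f = G.s e, ((1 - p) * S G f) * star ((1 - p) * S G f) = 0 := by
    have h1 : (1 - p) * p * (1 - p) = 0 := by
      have : (1 - p) * p = 0 := by rw [sub_mul, one_mul, hpp, sub_self]
      rw [this, zero_mul]
    have h2 : p = ∑ f with G.s f = G.s e, S G f * star (S G f) := ck G _ fun h => h e rfl
    have h3 : (1 - p) * (∑ f with G.s f = G.s e, S G f * star (S G f)) * (1 - p) = 0 := by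
      rwa [← h2]
    rw [Finset.mul_sum, Finset.sum_mul] at h3
    rw [← h3]
    refine Finset.sum_congr rfl fun f _ => ?_
    rw [StarMul.star_mul, star_sub, star_one, hps]
    simp only [mul_assoc]
  have h2 := (Finset.sum_eq_zero_iff_of_nonneg (fun f _ => mul_star_self_nonneg _)).1 h0 e
    (by simp)
  have h3 := (CStarRing.mul_star_self_eq_zero_iff _).1 h2
  rw [sub_mul, one_mul, sub_eq_zero] at h3
  exact h3.symm

theorem Spath_nil (v : V) : Spath G (.nil G v) = P G v := by
  simp [Spath, DirGraph.Path.nil]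

theorem Spath_single (e : E) : Spath G (.single G e) = S G e := by
  simp [Spath, DirGraph.Path.single, P_mul_S]

/-- A Cuntz-Krieger family multiplied by phases. -/
def rotateFamily (u : E → Circle) (i : G.CKFamily Op) : G.CKFamily Op where
  P := i.P
  S e := (u e : ℂ) • i.S e
  proj := i.proj
  orth := i.orth
  sum_proj := i.sum_proj
  star_mul e := by
    rw [star_smul, smul_mul_smul_comm, i.star_mul, Complex.star_def, ← Circle.coe_inv_eq_conj,
      ← Circle.coe_mul, inv_mul_cancel, Circle.coe_one, one_smul]
  ck v hv := by
    rw [i.ck v hv]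
    refine Finset.sum_congr rfl fun e _ => ?_
    rw [star_smul, smul_mul_smul_comm, Complex.star_def, ← Circle.coe_inv_eq_conj,
      ← Circle.coe_mul, mul_inv_cancel, Circle.coe_one, one_smul]

/-- The endomorphism (in fact automorphism) of `C*(G)` with `P_v ↦ P_v`, `S_e ↦ u e • S_e`. -/
def rotate (u : E → Circle) : GraphCStar G →⋆ₐ[ℂ] GraphCStar G :=
  genMap (rotateFamily G u) (by
    rintro _ (⟨v, rfl⟩ | ⟨e, rfl⟩)
    · exact subset_gen (Or.inl ⟨v, rfl⟩)
    · exact SMulMemClass.smul_mem (u e : ℂ)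
        (subset_gen (Set.mem_union_right (Set.range (univP G)) (Set.mem_range_self e))))

theorem rotate_P (u : E → Circle) (v : V) : rotate G u (P G v) = P G v := rfl

theorem rotate_S (u : E → Circle) (e : E) : rotate G u (S G e) = (u e : ℂ) • S G e := rfl

end GraphCStar

end GraphCStar

/-! ### Tensor products of C*-algebras -/

section Tensor

variable (A B : Type*) [CStarAlgebra A] [CStarAlgebra B]

/-- Pairs of commuting representations of `A` and `B` on `ℓ²(ℕ)`. -/
def CommReps : Type _ :=
  {p : (A →⋆ₐ[ℂ] Op) × (B →⋆ₐ[ℂ] Op) // ∀ a b, Commute (p.1 a) (p.2 b)}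

variable {A B}

/-- The family `(π a)`, indexed by all pairs of commuting representations `(π, ρ)`. -/
def famL : A →⋆ₐ[ℂ] Fam (CommReps A B) where
  toFun a := ⟨fun p => p.1.1 a, memℓp_infty ⟨‖a‖, by
    rintro _ ⟨p, rfl⟩; exact NonUnitalStarAlgHom.norm_apply_le p.1.1 a⟩⟩
  map_one' := Subtype.ext <| funext fun p => map_one p.1.1
  map_mul' a b := Subtype.ext <| funext fun p => map_mul p.1.1 a b
  map_zero' := Subtype.ext <| funext fun p => map_zero p.1.1
  map_add' a b := Subtype.ext <| funext fun p => map_add p.1.1 a b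
  commutes' c := Subtype.ext <| funext fun p => AlgHomClass.commutes p.1.1 c
  map_star' a := Subtype.ext <| funext fun p => map_star p.1.1 a

/-- The family `(ρ b)`, indexed by all pairs of commuting representations `(π, ρ)`. -/
def famR : B →⋆ₐ[ℂ] Fam (CommReps A B) where
  toFun a := ⟨fun p => p.1.2 a, memℓp_infty ⟨‖a‖, by
    rintro _ ⟨p, rfl⟩; exact NonUnitalStarAlgHom.norm_apply_le p.1.2 a⟩⟩
  map_one' := Subtype.ext <| funext fun p => map_one p.1.2
  map_mul' a b := Subtype.ext <| funext fun p => map_mul p.1.2 a b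
  map_zero' := Subtype.ext <| funext fun p => map_zero p.1.2
  map_add' a b := Subtype.ext <| funext fun p => map_add p.1.2 a b
  commutes' c := Subtype.ext <| funext fun p => AlgHomClass.commutes p.1.2 c
  map_star' a := Subtype.ext <| funext fun p => map_star p.1.2 a

variable (A B)

/-- The (maximal) C*-tensor product `A ⊗ B` of separable unital C*-algebras, generated by commuting
copies of `A` and `B`. Graph C*-algebras are nuclear, so that for them there is only one C*-tensor
product. -/
def CTensor : Type _ :=
  Gen (Set.range (famL : A → Fam (CommReps A B)) ∪ Set.range (famR : B → Fam (CommReps A B)))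

instance : CStarAlgebra (CTensor A B) :=
  inferInstanceAs (CStarAlgebra (Gen (Set.range (famL : A → Fam (CommReps A B)) ∪
    Set.range (famR : B → Fam (CommReps A B)))))

instance : PartialOrder (CTensor A B) := CStarAlgebra.spectralOrder _

instance : StarOrderedRing (CTensor A B) := CStarAlgebra.spectralOrderedRing _

namespace CTensor

variable {A B}

/-- `a ↦ a ⊗ 1`. -/
def inl : A →⋆ₐ[ℂ] CTensor A B :=
  (famL : A →⋆ₐ[ℂ] Fam (CommReps A B)).codRestrict (Gen _) fun a => subset_gen (Or.inl ⟨a, rfl⟩)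

/-- `b ↦ 1 ⊗ b`. -/
def inr : B →⋆ₐ[ℂ] CTensor A B :=
  (famR : B →⋆ₐ[ℂ] Fam (CommReps A B)).codRestrict (Gen _) fun b => subset_gen (Or.inr ⟨b, rfl⟩)

theorem inl_mul_inr (a : A) (b : B) : (inl a * inr b : CTensor A B) = inr b * inl a :=
  Subtype.ext <| Subtype.ext <| funext fun p => p.2 a b

/-- The tensor product `α ⊗ β` of endomorphisms. -/
def map (α : A →⋆ₐ[ℂ] A) (β : B →⋆ₐ[ℂ] B) : CTensor A B →⋆ₐ[ℂ] CTensor A B :=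
  genMap (fun p : CommReps A B => ⟨(p.1.1.comp α, p.1.2.comp β), fun a b => p.2 (α a) (β b)⟩) (by
    rintro _ (⟨a, rfl⟩ | ⟨b, rfl⟩)
    · exact subset_gen (Or.inl ⟨α a, rfl⟩)
    · exact subset_gen (Or.inr ⟨β b, rfl⟩))

theorem map_inl (α : A →⋆ₐ[ℂ] A) (β : B →⋆ₐ[ℂ] B) (a : A) :
    map α β (inl a) = inl (α a) := rfl

theorem map_inr (α : A →⋆ₐ[ℂ] A) (β : B →⋆ₐ[ℂ] B) (b : B) :
    map α β (inr b) = inr (β b) := rfl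

end CTensor

end Tensor

/-! ### Weights and the KMS condition -/

section Weights

variable {A : Type*} [CStarAlgebra A] [PartialOrder A] [StarOrderedRing A]

/-- `σ` is a time evolution: a pointwise norm-continuous one-parameter group of automorphisms. -/
def IsTimeEvolution (σ : ℝ → (A ≃⋆ₐ[ℂ] A)) : Prop :=
  (∀ a, σ 0 a = a) ∧ (∀ t t' a, σ (t + t') a = σ t (σ t' a)) ∧
    ∀ a, Continuous fun t => σ t a

variable (A) in
/-- A weight on a C*-algebra: an additive and positively homogeneous function on the positive
elements, with values in `[0, ∞]`. Only the values at positive elements are meaningful. -/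
structure Weight where
  toFun : A → ℝ≥0∞
  map_add : ∀ a b, 0 ≤ a → 0 ≤ b → toFun (a + b) = toFun a + toFun b
  map_smul : ∀ (c : ℝ≥0) (a : A), 0 ≤ a → toFun ((c : ℂ) • a) = c * toFun a

namespace Weight

variable (Ψ : Weight A)

/-- `𝓜_Ψ`, the span of the positive elements of finite weight. -/
def finiteSpan : Submodule ℂ A := Submodule.span ℂ {a | 0 ≤ a ∧ Ψ.toFun a < ∞}

/-- `𝓝_Ψ`. -/
def squareFinite : Set A := {x | Ψ.toFun (star x * x) < ∞}

/-- `L` is the linear extension of `Ψ` to `𝓜_Ψ`. -/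
def IsLinearExtension (L : Ψ.finiteSpan →ₗ[ℂ] ℂ) : Prop :=
  ∀ (a : A) (ha : 0 ≤ a ∧ Ψ.toFun a < ∞),
    L ⟨a, Submodule.subset_span ha⟩ = ((Ψ.toFun a).toReal : ℂ)

/-- Proper weights: nonzero, densely defined and lower semicontinuous. -/
def IsProper : Prop :=
  (∃ a, 0 ≤ a ∧ Ψ.toFun a ≠ 0) ∧ Dense (Ψ.finiteSpan : Set A) ∧
    ∀ c : ℝ≥0, IsClosed {a | 0 ≤ a ∧ Ψ.toFun a ≤ c}

/-- `Ψ`, with linear extension `L`, is a KMS weight for the time evolution `σ`: it is proper,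
invariant under `σ`, and for all `x, y ∈ 𝓝_Ψ ∩ 𝓝_Ψ*` there is a bounded continuous function `F` on
the closed strip `0 ≤ Im z ≤ 1`, analytic inside, with `F t = Ψ (σ_t x * y)` and
`F (t + i) = Ψ (y * σ_t x)` for real `t`. -/
def IsKMS (L : Ψ.finiteSpan →ₗ[ℂ] ℂ) (σ : ℝ → (A ≃⋆ₐ[ℂ] A)) : Prop :=
  Ψ.IsProper ∧ (∀ t a, 0 ≤ a → Ψ.toFun (σ t a) = Ψ.toFun a) ∧
    ∀ x y, x ∈ Ψ.squareFinite → star x ∈ Ψ.squareFinite →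
      y ∈ Ψ.squareFinite → star y ∈ Ψ.squareFinite →
      ∃ F : ℂ → ℂ, DifferentiableOn ℂ F {z | 0 < z.im ∧ z.im < 1} ∧
        ContinuousOn F {z | 0 ≤ z.im ∧ z.im ≤ 1} ∧
        (∃ C : ℝ, ∀ z : ℂ, 0 ≤ z.im → z.im ≤ 1 → ‖F z‖ ≤ C) ∧
        ∀ t : ℝ, (∃ h : σ t x * y ∈ Ψ.finiteSpan, F t = L ⟨σ t x * y, h⟩) ∧
          ∃ h : y * σ t x ∈ Ψ.finiteSpan, F (t + Complex.I) = L ⟨y * σ t x, h⟩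

end Weight

end Weights

/-! ### Oriented 2-dimensional CW complexes -/

/-- The combinatorial data of an oriented 2-dimensional CW complex with vertices `V`, edges `E` and
faces `F`: a directed graph, the 1-skeleton, and for each face `f` its boundary `ν f`, a sequence of
edges up to cyclic permutation in which each edge ends where the cyclically next one starts. -/
structure OrientedCW (V E F : Type*) where
  skeleton : DirGraph V E
  ν : F → Cycle E
  closed : ∀ f, (ν f).Chain fun e e' => skeleton.r e = skeleton.s e'

namespace OrientedCW

section

variable {V E F : Type*} (B : OrientedCW V E F)

/-- A listing `(e₀, …, e_{n-1})` of the boundary of the face `f`, starting anywhere. -/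
def listing (f : F) : List E := Quotient.out (s := List.IsRotated.setoid E) (B.ν f)

/-- The appearances `(f, i)` of edges in boundaries of faces. These are the edges of the boundary
graph; `(f, i)` is the edge `(σ, e)` for `σ = f` and `e = e_i`. -/
abbrev Corner : Type _ := Σ f : F, Fin (B.listing f).length

/-- The boundary graph: its vertices are the edges of `B`, and there is an edge from `e` to `e'` for
each instance that `e'` cyclically follows `e` in the boundary of a face. -/
def boundary : DirGraph E B.Corner where
  s c := (B.listing c.1).get c.2
  r c := (B.listing c.1).get ⟨(c.2 + 1) % (B.listing c.1).length,
    Nat.mod_lt _ (Nat.lt_of_le_of_lt (Nat.zero_le _) c.2.isLt)⟩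

/-- Rank 2 graph weights `(g, lamT, lam, η)`, with `lamT` in the role of `λ̃`: graph weights
`(g, lamT)` on the 1-skeleton and `(lam, η)` on the boundary graph, where the edge function of the
latter depends on the face only. -/
def IsRankTwoGraphWeight [Fintype E] [Fintype F] (g : V → ℝ) (lamT lam : E → ℝ) (η : F → ℝ) :
    Prop :=
  B.skeleton.IsGraphWeight g lamT ∧ B.boundary.IsGraphWeight lam (fun c => η c.1) ∧ ∀ f, 0 ≤ η f

/-- A quadruple of functions is faithful if all of them vanish nowhere. -/
def IsFaithfulData (g : V → ℝ) (lamT lam : E → ℝ) (η : F → ℝ) : Prop :=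
  (∀ v, g v ≠ 0) ∧ (∀ e, lamT e ≠ 0) ∧ (∀ e, lam e ≠ 0) ∧ ∀ f, η f ≠ 0

end

variable {V E F : Type*} [Fintype V] [Fintype E] [Fintype F] (B : OrientedCW V E F)

/-- `C*(B) = C*(B^(1)) ⊗ C*(B_∂)`. -/
abbrev CStar : Type _ := CTensor (GraphCStar B.skeleton) (GraphCStar B.boundary)

/-- `P_v`, for a vertex `v` of `B`. -/
def Pv (v : V) : B.CStar := CTensor.inl (GraphCStar.P B.skeleton v)

/-- `S_e`, for an edge `e` of `B`. -/
def Se (e : E) : B.CStar := CTensor.inl (GraphCStar.S B.skeleton e)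

/-- `P_e`, for an edge `e` of `B`, that is, a vertex of the boundary graph. -/
def Pe (e : E) : B.CStar := CTensor.inr (GraphCStar.P B.boundary e)

/-- `S_{σ,e}`, for an edge `c = (σ, e)` of the boundary graph. -/
def Sc (c : B.Corner) : B.CStar := CTensor.inr (GraphCStar.S B.boundary c)

/-- `S_μ S_ν* S_Ω S_Λ*`, for paths `μ, ν` in the 1-skeleton and `Ω, Λ` in the boundary graph. -/
def monomial (μ ν : B.skeleton.Path) (Ω Λ : B.boundary.Path) : B.CStar :=
  CTensor.inl (GraphCStar.Spath _ μ) * star (CTensor.inl (GraphCStar.Spath _ ν)) *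
    CTensor.inr (GraphCStar.Spath _ Ω) * star (CTensor.inr (GraphCStar.Spath _ Λ))

/-- `𝓜_B`, the linear span of all `S_μ S_ν* S_Ω S_Λ*` with `r(μ) = r(ν)` and `r(Ω) = r(Λ)`. -/
def MB : Submodule ℂ B.CStar :=
  Submodule.span ℂ {x | ∃ μ ν Ω Λ, μ.tgt = ν.tgt ∧ Ω.tgt = Λ.tgt ∧ x = B.monomial μ ν Ω Λ}

theorem monomial_mem {μ ν : B.skeleton.Path} {Ω Λ : B.boundary.Path} (h : μ.tgt = ν.tgt)
    (h' : Ω.tgt = Λ.tgt) : B.monomial μ ν Ω Λ ∈ B.MB :=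
  Submodule.subset_span ⟨μ, ν, Ω, Λ, h, h', rfl⟩

/-- The gauge action of `U(1) × U(1)`: `S_e ↦ z • S_e` and `S_{σ,e} ↦ w • S_{σ,e}`. -/
def gauge (z w : Circle) : B.CStar →⋆ₐ[ℂ] B.CStar :=
  CTensor.map (GraphCStar.rotate _ fun _ => z) (GraphCStar.rotate _ fun _ => w)

theorem gauge_Se (z w : Circle) (e : E) : B.gauge z w (B.Se e) = (z : ℂ) • B.Se e :=
  (congrArg CTensor.inl (GraphCStar.rotate_S _ _ e)).trans (map_smul CTensor.inl _ _)

theorem gauge_Sc (z w : Circle) (c : B.Corner) : B.gauge z w (B.Sc c) = (w : ℂ) • B.Sc c :=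
  (congrArg CTensor.inr (GraphCStar.rotate_S _ _ c)).trans (map_smul CTensor.inr _ _)

/-- A weight on `𝓜_B`, given as a linear functional (all its values are finite), is a linear
functional that is nonnegative on the elements `x* x`. -/
def IsWeight (ψ : B.MB →ₗ[ℂ] ℂ) : Prop :=
  ∀ x y : B.MB, (y : B.CStar) = star (x : B.CStar) * x → 0 ≤ ψ y

/-- Faithfulness of a weight on `𝓜_B`. -/
def IsFaithful (ψ : B.MB →ₗ[ℂ] ℂ) : Prop :=
  ∀ x y : B.MB, (y : B.CStar) = star (x : B.CStar) * x → ψ y = 0 → x = 0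

/-- Invariance of a functional on `𝓜_B` under the gauge action. -/
def IsGaugeInvariant (ψ : B.MB →ₗ[ℂ] ℂ) : Prop :=
  ∀ (z w : Circle) (x : B.MB), ∃ y : B.MB, (y : B.CStar) = B.gauge z w x ∧ ψ y = ψ x

/-- `Ψ` is a weight on `C*(B)`, finite on `𝓜_B`, whose linear extension `L` restricts to `ψ`. -/
def Extends (Ψ : Weight B.CStar) (L : Ψ.finiteSpan →ₗ[ℂ] ℂ) (ψ : B.MB →ₗ[ℂ] ℂ) : Prop :=
  Ψ.IsLinearExtension L ∧
    ∀ x : B.MB, ∃ h : (x : B.CStar) ∈ Ψ.finiteSpan, L ⟨x, h⟩ = ψ x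

open Classical in
/-- `ψ(S_μ S_ν* S_Ω S_Λ*) = δ_{μ,ν} δ_{Ω,Λ} λ̃(μ) g(r(μ)) η(Ω) λ(r(Ω))`, where `λ̃(μ)` and `η(Ω)` are
the products over the edges of the paths. -/
def IsProductFormula (g : V → ℝ) (lamT lam : E → ℝ) (η : F → ℝ) (ψ : B.MB →ₗ[ℂ] ℂ) : Prop :=
  ∀ (μ ν : B.skeleton.Path) (Ω Λ : B.boundary.Path) (h : μ.tgt = ν.tgt) (h' : Ω.tgt = Λ.tgt),
    ψ ⟨B.monomial μ ν Ω Λ, B.monomial_mem h h'⟩ =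
      if μ = ν ∧ Ω = Λ then
        (((μ.edges.map lamT).prod * g μ.tgt *
          ((Ω.edges.map fun c => η c.1).prod * lam Ω.tgt) : ℝ) : ℂ)
      else 0

/-! The elements of `𝓜_B` at which a weight is evaluated in order to recover the four functions. -/

theorem inl_mem {μ ν : B.skeleton.Path} (h : μ.tgt = ν.tgt) :
    (CTensor.inl (GraphCStar.Spath _ μ * star (GraphCStar.Spath _ ν)) : B.CStar) ∈ B.MB := by
  have h1 : (CTensor.inl (GraphCStar.Spath _ μ * star (GraphCStar.Spath _ ν)) : B.CStar) =
      ∑ e, B.monomial μ ν (.nil _ e) (.nil _ e) := by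
    have hp := fun e => GraphCStar.proj B.boundary e
    simp only [monomial, mul_assoc, ← map_star, ← map_mul, GraphCStar.Spath_nil,
      (hp _).isSelfAdjoint.star_eq, (hp _).isIdempotentElem.eq]
    rw [← Finset.mul_sum, ← map_sum, GraphCStar.sum_proj, map_one, mul_one]
  rw [h1]
  exact Submodule.sum_mem _ fun e _ => B.monomial_mem h rfl

theorem inr_mem {Ω Λ : B.boundary.Path} (h : Ω.tgt = Λ.tgt) :
    (CTensor.inr (GraphCStar.Spath _ Ω * star (GraphCStar.Spath _ Λ)) : B.CStar) ∈ B.MB := by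
  have h1 : (CTensor.inr (GraphCStar.Spath _ Ω * star (GraphCStar.Spath _ Λ)) : B.CStar) =
      ∑ v, B.monomial (.nil _ v) (.nil _ v) Ω Λ := by
    have hp := fun v => GraphCStar.proj B.skeleton v
    simp only [monomial, ← map_star, ← map_mul, GraphCStar.Spath_nil,
      (hp _).isSelfAdjoint.star_eq, (hp _).isIdempotentElem.eq]
    simp only [mul_assoc, ← map_mul]
    rw [← Finset.sum_mul, ← map_sum, GraphCStar.sum_proj, map_one, one_mul]
  rw [h1]
  exact Submodule.sum_mem _ fun e _ => B.monomial_mem rfl h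

theorem Pv_mem (v : V) : B.Pv v ∈ B.MB := by
  have h := B.inl_mem (μ := .nil _ v) (ν := .nil _ v) rfl
  rwa [GraphCStar.Spath_nil, (GraphCStar.proj _ v).isSelfAdjoint.star_eq,
    (GraphCStar.proj _ v).isIdempotentElem.eq] at h

theorem Pe_mem (e : E) : B.Pe e ∈ B.MB := by
  have h := B.inr_mem (Ω := .nil _ e) (Λ := .nil _ e) rfl
  rwa [GraphCStar.Spath_nil, (GraphCStar.proj _ e).isSelfAdjoint.star_eq,
    (GraphCStar.proj _ e).isIdempotentElem.eq] at h

/-- `P_v` as an element of `𝓜_B`. -/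
def mPv (v : V) : B.MB := ⟨B.Pv v, B.Pv_mem v⟩

/-- `P_e` as an element of `𝓜_B`. -/
def mPe (e : E) : B.MB := ⟨B.Pe e, B.Pe_mem e⟩

/-- `S_e S_e*` as an element of `𝓜_B`. -/
def mSeStar (e : E) : B.MB := ⟨B.Se e * star (B.Se e), by
  have h := B.inl_mem (μ := .single _ e) (ν := .single _ e) rfl
  rwa [GraphCStar.Spath_single, map_mul, map_star] at h⟩

/-- `S_e* S_e` as an element of `𝓜_B`. -/
def mStarSe (e : E) : B.MB := ⟨star (B.Se e) * B.Se e, by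
  have h := B.Pv_mem (B.skeleton.r e)
  rwa [Pv, ← GraphCStar.star_mul, map_mul, map_star] at h⟩

/-- `S_{σ,e} S_{σ,e}*` as an element of `𝓜_B`. -/
def mScStar (c : B.Corner) : B.MB := ⟨B.Sc c * star (B.Sc c), by
  have h := B.inr_mem (Ω := .single _ c) (Λ := .single _ c) rfl
  rwa [GraphCStar.Spath_single, map_mul, map_star] at h⟩

/-- `S_{σ,e}* S_{σ,e}` as an element of `𝓜_B`. -/
def mStarSc (c : B.Corner) : B.MB := ⟨star (B.Sc c) * B.Sc c, by
  have h := B.Pe_mem (B.boundary.r c)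
  rwa [Pe, ← GraphCStar.star_mul, map_mul, map_star] at h⟩

end OrientedCW

end CWKMS

end

/-!
Everything is derived from one positive functional `φ` on `C*(B)` with
`φ(S_μ S_ν* S_Ω S_Λ*) = δ_{μ,ν} δ_{Ω,Λ} lamT(μ) g(r(μ)) η(Ω) lam(r(Ω))`.

For its construction, each of the two graphs acts on the countable set of pairs `(x, k)`, where `x`
is an infinite path that eventually follows a fixed choice of edges (sinks are provided with a loop)
and `k` is an integer recording the degree: `S_e` maps `(x, k)` to `(e x, k + 1)`. The actions on
the two factors of the product of these sets commute, so that they give a representation of `C*(B)`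
on `ℓ²`. A diagonal matrix coefficient of `S_μ S_ν*` at `(x, k)` is `1` if `μ = ν` is an initial
segment of `x`, and `0` otherwise; the integer `k` excludes paths `μ ≠ ν` of different length. If
vector functionals are averaged over all pairs of paths of length `N`, with the weights
`lamT(μ) g(r(μ))` and `η(Ω) lam(r(Ω))`, the equations of a graph weight say exactly that the values
on a fixed `S_μ S_ν* S_Ω S_Λ*` no longer depend on `N` once `N` is large. The averages are uniformly
bounded, so they have a limit along an ultrafilter, and this is `φ` (`exists_productState`).

The product formula implies `φ(S_e y) = lamT(e) φ(y S_e)` and `φ(S_c y) = η(c) φ(y S_c)`, first for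
`y = S_μ S_ν* S_Ω S_Λ*` (`GraphCStar.HasPathValues.S_mul`) and by density for all `y`. Products and
adjoints of elements with such a relation have one too, so all `S_μ S_ν* S_Ω S_Λ*` are eigenvectors
of the time evolution for which the KMS function is an exponential; the Phragmén-Lindelöf principle
extends the KMS condition from their dense span to the whole algebra (`exists_isStripFun`).

For the converse, faithfulness and `P_v, P_e ≠ 0`, which is visible in the same representation, make
all the values in question positive, and the equations of a rank 2 graph weight are the
Cuntz-Krieger relations, evaluated (`IsWeight.exists_rankTwo`).
-/

noncomputable section

namespace CWKMS

/-! ### Density from stability under the generators -/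

/-- A subspace of a generated C*-algebra that contains `1` and is stable under left multiplication
by the generators and their adjoints is dense. -/
theorem gen_dense {I : Type*} {G : Set (Fam I)} (M : Submodule ℂ (Gen G)) (h1 : 1 ∈ M)
    (hM : ∀ x (hx : x ∈ G), ∀ m ∈ M,
      (⟨x, subset_gen hx⟩ : Gen G) * m ∈ M ∧ star (⟨x, subset_gen hx⟩ : Gen G) * m ∈ M) :
    Dense (M : Set (Gen G)) := by
  have key : ∀ x ∈ StarAlgebra.adjoin ℂ G, ∀ m ∈ M,
      (∃ y ∈ M, (y : Fam I) = x * m) ∧ ∃ y ∈ M, (y : Fam I) = star x * m := by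
    intro x hx
    induction hx using StarAlgebra.adjoin_induction with
    | mem x hx => exact fun m hm => ⟨⟨_, (hM x hx m hm).1, rfl⟩, ⟨_, (hM x hx m hm).2, rfl⟩⟩
    | algebraMap c =>
      refine fun m hm => ⟨⟨c • m, M.smul_mem _ hm, ?_⟩, ⟨star c • m, M.smul_mem _ hm, ?_⟩⟩
      · rw [← Algebra.smul_def]; rfl
      · rw [← algebraMap_star_comm, ← Algebra.smul_def]; rfl
    | add x y _ _ ihx ihy =>
      intro m hm
      obtain ⟨⟨a, ha, ha'⟩, ⟨b, hb, hb'⟩⟩ := ihx m hm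
      obtain ⟨⟨c, hc, hc'⟩, ⟨d, hd, hd'⟩⟩ := ihy m hm
      refine ⟨⟨a + c, M.add_mem ha hc, ?_⟩, ⟨b + d, M.add_mem hb hd, ?_⟩⟩
      · rw [add_mul, ← ha', ← hc']; rfl
      · rw [star_add, add_mul, ← hb', ← hd']; rfl
    | mul x y _ _ ihx ihy =>
      intro m hm
      obtain ⟨⟨a, ha, ha'⟩, -⟩ := ihy m hm
      obtain ⟨⟨b, hb, hb'⟩, -⟩ := ihx a ha
      obtain ⟨-, ⟨c, hc, hc'⟩⟩ := ihx m hm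
      obtain ⟨-, ⟨d, hd, hd'⟩⟩ := ihy c hc
      refine ⟨⟨b, hb, ?_⟩, ⟨d, hd, ?_⟩⟩
      · rw [hb', ha']; exact (mul_assoc x y (m : Fam I)).symm
      · rw [hd', hc', star_mul]; exact (mul_assoc (star y) (star x) (m : Fam I)).symm
    | star x _ ih => exact fun m hm => ⟨(ih m hm).2, by rw [star_star]; exact (ih m hm).1⟩
  intro a
  rw [Topology.IsInducing.subtypeVal.closure_eq_preimage_closure_image]
  have ha : (a : Fam I) ∈ closure (StarAlgebra.adjoin ℂ G : Set (Fam I)) := a.2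
  refine closure_mono ?_ ha
  intro x hx
  obtain ⟨y, hy, hyx⟩ := (key x hx 1 h1).1
  exact ⟨y, hy, by rw [hyx]; exact mul_one x⟩

namespace DirGraph

variable {V E : Type*} {G : DirGraph V E}

/-- The path `e μ`. -/
def Path.cons (e : E) (μ : G.Path) (h : G.r e = μ.src) : G.Path :=
  ⟨G.s e, e :: μ.edges, μ.tgt, rfl, h ▸ μ.isPath⟩

theorem IsPath.append {l l' : List E} {u v w : V} (h : G.IsPath u l v) (h' : G.IsPath v l' w) :
    G.IsPath u (l ++ l') w := by
  induction l generalizing u with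
  | nil => cases h; exact h'
  | cons e l ih => exact ⟨h.1, ih h.2⟩

/-- The path `μ e`. -/
def Path.snoc (μ : G.Path) (e : E) (h : μ.tgt = G.s e) : G.Path :=
  ⟨μ.src, μ.edges ++ [e], G.r e, μ.isPath.append ⟨h.symm, rfl⟩⟩

theorem Path.eq_nil_or_cons (μ : G.Path) :
    (∃ v, μ = .nil G v) ∨ ∃ e ν, ∃ h : G.r e = Path.src ν, μ = .cons e ν h := by
  obtain ⟨v, l, w, h⟩ := μ
  cases l with
  | nil => cases h; exact Or.inl ⟨v, rfl⟩
  | cons e l => obtain ⟨rfl, h⟩ := h; exact Or.inr ⟨e, ⟨_, l, w, h⟩, rfl, rfl⟩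

theorem Path.cons_inj {e : E} {μ ν : G.Path} {h : G.r e = μ.src} {h' : G.r e = ν.src} :
    Path.cons e μ h = Path.cons e ν h' ↔ μ = ν := by
  constructor
  · intro H
    rw [Path.ext_iff] at H ⊢
    exact ⟨h.symm.trans h', (List.cons.inj H.2.1).2, H.2.2⟩
  · rintro rfl; rfl

end DirGraph

namespace GraphCStar

/-! ### The Cuntz-Krieger relations and products of paths -/

section

variable {V E : Type*} [Fintype V] [Fintype E] (G : DirGraph V E)

theorem P_mul_P_self (v : V) : P G v * P G v = P G v := (proj G v).isIdempotentElem

theorem star_P (v : V) : star (P G v) = P G v := (proj G v).isSelfAdjoint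

theorem P_mul_P {v w : V} (h : v ≠ w) : P G v * P G w = 0 :=
  ext_family G fun i => i.orth v w h

theorem S_mul_P (e : E) : S G e * P G (G.r e) = S G e := by
  have h : star (S G e * (1 - P G (G.r e))) * (S G e * (1 - P G (G.r e))) = 0 := by
    rw [StarMul.star_mul, star_sub, star_one, star_P, mul_assoc, ← mul_assoc (star (S G e)),
      star_mul, mul_sub, mul_one, P_mul_P_self, sub_self, mul_zero]
  have h' := (CStarRing.star_mul_self_eq_zero_iff _).1 h
  rw [mul_sub, mul_one, sub_eq_zero] at h'
  exact h'.symm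

theorem star_S_mul_P (e : E) : star (S G e) * P G (G.s e) = star (S G e) := by
  rw [← star_P, ← StarMul.star_mul, P_mul_S]

theorem P_mul_star_S (e : E) : P G (G.r e) * star (S G e) = star (S G e) := by
  rw [← star_P, ← StarMul.star_mul, S_mul_P]

theorem P_mul_S_of_ne {e : E} {v : V} (h : v ≠ G.s e) : P G v * S G e = 0 := by
  rw [← P_mul_S, ← mul_assoc, P_mul_P G h, zero_mul]

/-- The ranges of the `S_e` are mutually orthogonal: `S_e* (∑ S_f S_f*) S_e = S_e* S_e` leaves no
room for the positive elements `S_e* S_f S_f* S_e` with `f ≠ e`. -/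
theorem star_S_mul_S_of_ne {e f : E} (hef : e ≠ f) : star (S G e) * S G f = 0 := by
  classical
  by_cases hs : G.s e = G.s f
  swap
  · rw [← star_S_mul_P, mul_assoc, P_mul_S_of_ne G hs, mul_zero]
  let _ := CStarAlgebra.spectralOrder (GraphCStar G)
  let _ := CStarAlgebra.spectralOrderedRing (GraphCStar G)
  have h1 : ∑ g with G.s g = G.s e, star (S G e) * (S G g * star (S G g)) * S G e =
      P G (G.r e) := by
    rw [← Finset.sum_mul, ← Finset.mul_sum]
    have h := ck G (G.s e) fun h => h e rfl
    have h' : (∑ g with G.s g = G.s e, S G g * star (S G g)) = P G (G.s e) := by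
      rw [h]
    rw [h', star_S_mul_P, star_mul]
  have he : e ∈ Finset.univ.filter fun g => G.s g = G.s e := by simp
  rw [← Finset.add_sum_erase _ _ he] at h1
  have h2 : star (S G e) * (S G e * star (S G e)) * S G e = P G (G.r e) := by
    rw [← mul_assoc, star_mul, P_mul_star_S, star_mul]
  rw [h2, add_eq_left] at h1
  have h3 := (Finset.sum_eq_zero_iff_of_nonneg (fun g _ => ?_)).1 h1 f (by simp [hs, hef.symm])
  · refine (CStarRing.mul_star_self_eq_zero_iff _).1 ?_
    rw [StarMul.star_mul, star_star, ← h3]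
    simp only [mul_assoc]
  · have := mul_star_self_nonneg (star (S G e) * S G g)
    rw [StarMul.star_mul, star_star] at this
    simpa only [mul_assoc] using this

theorem P_mul_Spath (μ : G.Path) : P G μ.src * Spath G μ = Spath G μ := by
  rw [Spath, ← mul_assoc, P_mul_P_self]

theorem P_mul_Spath_of_ne {v : V} {μ : G.Path} (h : v ≠ μ.src) : P G v * Spath G μ = 0 := by
  rw [Spath, ← mul_assoc, P_mul_P G h, zero_mul]

theorem Spath_cons (e : E) (μ : G.Path) (h : G.r e = μ.src) :
    Spath G (.cons e μ h) = S G e * Spath G μ := by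
  rw [Spath, Spath, ← h, ← mul_assoc, S_mul_P]
  change P G (G.s e) * ((e :: μ.edges).map (S G)).prod = _
  rw [List.map_cons, List.prod_cons, ← mul_assoc, P_mul_S]

theorem Spath_mul_P (μ : G.Path) : Spath G μ * P G μ.tgt = Spath G μ := by
  obtain ⟨v, l, w, h⟩ := μ
  induction l generalizing v with
  | nil => cases h; simp [Spath, P_mul_P_self]
  | cons e l ih =>
    obtain ⟨rfl, h⟩ := h
    have := Spath_cons G e ⟨_, l, w, h⟩ rfl
    change Spath G (.cons e ⟨_, l, w, h⟩ rfl) * _ = Spath G (.cons e ⟨_, l, w, h⟩ rfl)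
    rw [this, mul_assoc, ih]

theorem Spath_snoc (μ : G.Path) (e : E) (h : μ.tgt = G.s e) :
    Spath G (μ.snoc e h) = Spath G μ * S G e := by
  simp [Spath, DirGraph.Path.snoc, mul_assoc]

theorem Spath_mul_S_of_ne {μ : G.Path} {e : E} (h : μ.tgt ≠ G.s e) : Spath G μ * S G e = 0 := by
  rw [← Spath_mul_P, mul_assoc, P_mul_S_of_ne G h, mul_zero]

theorem S_mul_Spath_of_ne {e : E} {μ : G.Path} (h : G.r e ≠ μ.src) : S G e * Spath G μ = 0 := by
  rw [← S_mul_P, mul_assoc, P_mul_Spath_of_ne G h, mul_zero]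

theorem star_S_mul_Spath_cons (e : E) (μ : G.Path) (h : G.r e = μ.src) :
    star (S G e) * Spath G (.cons e μ h) = Spath G μ := by
  rw [Spath_cons, ← mul_assoc, star_mul, h, P_mul_Spath]

theorem star_S_mul_Spath_cons_of_ne {e f : E} (hef : e ≠ f) (μ : G.Path) (h : G.r f = μ.src) :
    star (S G e) * Spath G (.cons f μ h) = 0 := by
  rw [Spath_cons, ← mul_assoc, star_S_mul_S_of_ne G hef, zero_mul]

/-- The linear span of the elements `S_μ S_ν*` with `r(μ) = r(ν)`. -/
def pathSpan : Submodule ℂ (GraphCStar G) :=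
  Submodule.span ℂ {x | ∃ μ ν : G.Path, μ.tgt = ν.tgt ∧ x = Spath G μ * star (Spath G ν)}

theorem mem_pathSpan {μ ν : G.Path} (h : μ.tgt = ν.tgt) :
    Spath G μ * star (Spath G ν) ∈ pathSpan G := Submodule.subset_span ⟨μ, ν, h, rfl⟩

theorem P_mem_pathSpan (v : V) : P G v ∈ pathSpan G := by
  have := mem_pathSpan G (μ := .nil G v) (ν := .nil G v) rfl
  rwa [Spath_nil, star_P, P_mul_P_self] at this

theorem mul_mem_pathSpan {a : GraphCStar G}
    (ha : ∀ μ ν : G.Path, μ.tgt = ν.tgt → a * (Spath G μ * star (Spath G ν)) ∈ pathSpan G)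
    {m : GraphCStar G} (hm : m ∈ pathSpan G) : a * m ∈ pathSpan G := by
  have : pathSpan G ≤ (pathSpan G).comap (LinearMap.mulLeft ℂ a) := by
    refine Submodule.span_le.2 ?_
    rintro _ ⟨μ, ν, h, rfl⟩
    exact ha μ ν h
  exact this hm

/-- Density criterion for subspaces of a graph C*-algebra. -/
theorem dense_of_generators (M : Submodule ℂ (GraphCStar G)) (h1 : 1 ∈ M)
    (hP : ∀ v, ∀ m ∈ M, P G v * m ∈ M) (hS : ∀ e, ∀ m ∈ M, S G e * m ∈ M)
    (hS' : ∀ e, ∀ m ∈ M, star (S G e) * m ∈ M) : Dense (M : Set (GraphCStar G)) := by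
  refine gen_dense M h1 ?_
  rintro _ (⟨v, rfl⟩ | ⟨e, rfl⟩) m hm
  · refine ⟨hP v m hm, ?_⟩
    have := hP v m hm
    rw [← star_P] at this
    exact this
  · exact ⟨hS e m hm, hS' e m hm⟩

theorem dense_pathSpan : Dense (pathSpan G : Set (GraphCStar G)) := by
  refine dense_of_generators G _ ?_ (fun v m => mul_mem_pathSpan G fun μ ν h => ?_)
    (fun e m => mul_mem_pathSpan G fun μ ν h => ?_)
    (fun e m => mul_mem_pathSpan G fun μ ν h => ?_)
  · rw [← sum_proj]
    exact Submodule.sum_mem _ fun v _ => P_mem_pathSpan G v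
  · rw [← mul_assoc]
    by_cases hv : v = μ.src
    · rw [hv, P_mul_Spath]; exact mem_pathSpan G h
    · rw [P_mul_Spath_of_ne G hv, zero_mul]; exact Submodule.zero_mem _
  · rw [← mul_assoc]
    by_cases hv : G.r e = μ.src
    · rw [← Spath_cons G e μ hv]; exact mem_pathSpan G h
    · rw [S_mul_Spath_of_ne G hv, zero_mul]; exact Submodule.zero_mem _
  · rw [← mul_assoc]
    rcases μ.eq_nil_or_cons with ⟨v, rfl⟩ | ⟨f, μ, hf, rfl⟩
    · rw [Spath_nil]
      obtain rfl : v = ν.tgt := h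
      have h1 : star (S G e) * P G ν.tgt * star (Spath G ν) = star (Spath G ν * S G e) := by
        rw [mul_assoc, ← star_P, ← StarMul.star_mul, Spath_mul_P, StarMul.star_mul]
      rw [h1]
      by_cases hv : ν.tgt = G.s e
      · rw [← Spath_snoc G ν e hv]
        have := mem_pathSpan G (μ := .nil G (G.r e)) (ν := ν.snoc e hv) rfl
        rw [Spath_nil, ← star_P, ← StarMul.star_mul] at this
        convert this using 2
        exact (Spath_mul_P G (ν.snoc e hv)).symm
      · rw [Spath_mul_S_of_ne G hv, star_zero]; exact Submodule.zero_mem _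
    · by_cases hef : e = f
      · subst hef
        rw [star_S_mul_Spath_cons]; exact mem_pathSpan G h
      · rw [star_S_mul_Spath_cons_of_ne G hef, zero_mul]; exact Submodule.zero_mem _

open Classical in
/-- The functional `χ` has the values `χ(S_μ S_ν*) = δ_{μ,ν} lam(μ) g(r(μ)) C`. -/
def HasPathValues (g : V → ℝ) (lam : E → ℝ) (C : ℂ) (χ : GraphCStar G →ₗ[ℂ] ℂ) : Prop :=
  ∀ μ ν : G.Path, μ.tgt = ν.tgt → χ (Spath G μ * star (Spath G ν)) =
    if μ = ν then (((μ.edges.map lam).prod * g μ.tgt : ℝ) : ℂ) * C else 0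

/-- Moving `S_e` from the left to the right of `S_μ S_ν*` costs the factor `lam e`: both sides are
nonzero only if `ν = e μ`. -/
theorem HasPathValues.S_mul {g : V → ℝ} {lam : E → ℝ} {C : ℂ} {χ : GraphCStar G →ₗ[ℂ] ℂ}
    (hχ : HasPathValues G g lam C χ) (e : E) {μ ν : G.Path} (h : μ.tgt = ν.tgt) :
    χ (S G e * (Spath G μ * star (Spath G ν))) =
      lam e * χ (Spath G μ * star (Spath G ν) * S G e) := by
  classical
  rcases ν.eq_nil_or_cons with ⟨v, rfl⟩ | ⟨f, ν, hf, rfl⟩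
  · obtain rfl : μ.tgt = v := h
    rw [Spath_nil, star_P, Spath_mul_P]
    have hl : χ (S G e * Spath G μ) = 0 := by
      by_cases hv : G.r e = μ.src
      · have := hχ (.cons e μ hv) (.nil G μ.tgt) rfl
        rw [Spath_nil, star_P, Spath_cons, mul_assoc, Spath_mul_P, if_neg] at this
        · exact this
        · intro H
          cases congrArg DirGraph.Path.edges H
      · rw [S_mul_Spath_of_ne G hv, map_zero]
    have hr : χ (Spath G μ * S G e) = 0 := by
      by_cases hv : μ.tgt = G.s e
      · have := hχ (μ.snoc e hv) (.nil G (G.r e)) rfl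
        rw [Spath_nil, star_P, Spath_snoc, mul_assoc, S_mul_P, if_neg] at this
        · exact this
        · intro H
          have := congrArg DirGraph.Path.edges H
          simp [DirGraph.Path.snoc, DirGraph.Path.nil] at this
      · rw [Spath_mul_S_of_ne G hv, map_zero]
    rw [hl, hr, mul_zero]
  · have hr : star (Spath G (.cons f ν hf)) * S G e =
        if e = f then star (Spath G ν) else 0 := by
      rw [← star_star (S G e), ← StarMul.star_mul]
      split_ifs with hef
      · subst hef; rw [star_S_mul_Spath_cons]
      · rw [star_S_mul_Spath_cons_of_ne G hef, star_zero]
    rw [mul_assoc, hr, ← mul_assoc]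
    have hl : χ (S G e * Spath G μ * star (Spath G (.cons f ν hf))) =
        if e = f ∧ μ = ν then (lam e : ℂ) * (((μ.edges.map lam).prod * g μ.tgt : ℝ) * C) else 0 := by
      by_cases hv : G.r e = μ.src
      · rw [← Spath_cons G e μ hv, hχ (.cons e μ hv) _ h]
        by_cases H : e = f ∧ μ = ν
        · obtain ⟨rfl, rfl⟩ := H
          simp only [if_true, and_self]
          change (((e :: μ.edges).map lam).prod * g μ.tgt : ℝ) * C = _
          rw [List.map_cons, List.prod_cons]
          push_cast; ring
        · rw [if_neg H, if_neg]
          intro H'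
          obtain rfl : e = f := (List.cons.inj (congrArg DirGraph.Path.edges H')).1
          exact H ⟨rfl, DirGraph.Path.cons_inj.1 H'⟩
      · rw [S_mul_Spath_of_ne G hv, zero_mul, map_zero, if_neg]
        rintro ⟨rfl, rfl⟩
        exact hv hf
    rw [hl]
    by_cases hef : e = f
    · rw [if_pos hef, hχ μ ν h]
      by_cases H : μ = ν <;> simp [hef, H]
    · simp [hef]

/-- Multiplication by a vertex projection from the left or from the right makes no difference. -/
theorem HasPathValues.P_mul {g : V → ℝ} {lam : E → ℝ} {C : ℂ} {χ : GraphCStar G →ₗ[ℂ] ℂ}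
    (hχ : HasPathValues G g lam C χ) (v : V) {μ ν : G.Path} (h : μ.tgt = ν.tgt) :
    χ (P G v * (Spath G μ * star (Spath G ν))) =
      χ (Spath G μ * star (Spath G ν) * P G v) := by
  classical
  have hr : star (Spath G ν) * P G v = star (P G v * Spath G ν) := by
    rw [StarMul.star_mul, star_P]
  rw [mul_assoc, hr, ← mul_assoc]
  by_cases h1 : v = μ.src <;> by_cases h2 : v = ν.src
  · rw [h2, P_mul_Spath, ← h2, h1, P_mul_Spath]
  · rw [P_mul_Spath_of_ne G h2, star_zero, mul_zero, map_zero, h1, P_mul_Spath, hχ _ _ h, if_neg]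
    rintro rfl; exact h2 h1
  · rw [P_mul_Spath_of_ne G h1, zero_mul, map_zero, h2, P_mul_Spath, hχ _ _ h, if_neg]
    rintro rfl; exact h1 h2
  · rw [P_mul_Spath_of_ne G h1, P_mul_Spath_of_ne G h2, star_zero, zero_mul, mul_zero]

end

end GraphCStar

/-! ### The tensor product is spanned by elementary tensors -/

namespace CTensor

variable {A B : Type*} [CStarAlgebra A] [CStarAlgebra B]

theorem continuous_inl : Continuous (inl : A → CTensor A B) :=
  AddMonoidHomClass.continuous_of_bound inl 1 fun a => by
    rw [one_mul]; exact NonUnitalStarAlgHom.norm_apply_le (inl : A →⋆ₐ[ℂ] CTensor A B) a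

theorem continuous_inr : Continuous (inr : B → CTensor A B) :=
  AddMonoidHomClass.continuous_of_bound inr 1 fun b => by
    rw [one_mul]; exact NonUnitalStarAlgHom.norm_apply_le (inr : B →⋆ₐ[ℂ] CTensor A B) b

theorem dense_span_tensors :
    Dense (Submodule.span ℂ {x : CTensor A B | ∃ a b, x = inl a * inr b} : Set (CTensor A B)) := by
  set M := Submodule.span ℂ {x : CTensor A B | ∃ a b, x = inl a * inr b} with hM
  have hl : ∀ a : A, ∀ m ∈ M, inl a * m ∈ M := by
    intro a m hm
    have : M ≤ M.comap (LinearMap.mulLeft ℂ (inl a)) := by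
      refine Submodule.span_le.2 ?_
      rintro _ ⟨a', b, rfl⟩
      refine Submodule.subset_span ⟨a * a', b, ?_⟩
      rw [map_mul (inl : A →⋆ₐ[ℂ] CTensor A B), mul_assoc]; rfl
    exact this hm
  have hr : ∀ b : B, ∀ m ∈ M, inr b * m ∈ M := by
    intro b m hm
    have : M ≤ M.comap (LinearMap.mulLeft ℂ (inr b)) := by
      refine Submodule.span_le.2 ?_
      rintro _ ⟨a, b', rfl⟩
      refine Submodule.subset_span ⟨a, b * b', ?_⟩
      rw [LinearMap.mulLeft_apply, map_mul (inr : B →⋆ₐ[ℂ] CTensor A B), ← mul_assoc, ← mul_assoc,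
        inl_mul_inr]
    exact this hm
  have h1 : (1 : CTensor A B) ∈ M :=
    Submodule.subset_span ⟨1, 1, by rw [map_one, map_one, one_mul]⟩
  refine gen_dense M h1 ?_
  · rintro _ (⟨a, rfl⟩ | ⟨b, rfl⟩) m hm
    · refine ⟨hl a m hm, ?_⟩
      have := hl (star a) m hm
      rw [map_star] at this
      exact this
    · refine ⟨hr b m hm, ?_⟩
      have := hr (star b) m hm
      rw [map_star] at this
      exact this

end CTensor

namespace OrientedCW

variable {V E F : Type*} [Fintype V] [Fintype E] [Fintype F] (B : OrientedCW V E F)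

theorem monomial_eq (μ ν : B.skeleton.Path) (Ω Λ : B.boundary.Path) :
    B.monomial μ ν Ω Λ =
      CTensor.inl (GraphCStar.Spath _ μ * star (GraphCStar.Spath _ ν)) *
        CTensor.inr (GraphCStar.Spath _ Ω * star (GraphCStar.Spath _ Λ)) := by
  simp only [monomial, map_mul, map_star, mul_assoc]

theorem tensor_mem_MB {a : GraphCStar B.skeleton} {b : GraphCStar B.boundary}
    (ha : a ∈ GraphCStar.pathSpan B.skeleton) (hb : b ∈ GraphCStar.pathSpan B.boundary) :
    CTensor.inl a * CTensor.inr b ∈ B.MB := by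
  have h1 : ∀ b ∈ GraphCStar.pathSpan B.boundary, ∀ μ ν : B.skeleton.Path, μ.tgt = ν.tgt →
      (CTensor.inl (GraphCStar.Spath _ μ * star (GraphCStar.Spath _ ν)) *
        CTensor.inr b : B.CStar) ∈ B.MB := by
    intro b hb μ ν h
    have : GraphCStar.pathSpan B.boundary ≤ B.MB.comap ((LinearMap.mulLeft ℂ (CTensor.inl
      (GraphCStar.Spath _ μ * star (GraphCStar.Spath _ ν)) : B.CStar)).comp
        (CTensor.inr : _ →⋆ₐ[ℂ] B.CStar).toAlgHom.toLinearMap) := by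
      refine Submodule.span_le.2 ?_
      rintro _ ⟨Ω, Λ, h', rfl⟩
      have := B.monomial_mem h h'
      rw [monomial_eq] at this
      exact this
    exact this hb
  have : GraphCStar.pathSpan B.skeleton ≤ B.MB.comap ((LinearMap.mulRight ℂ
      (CTensor.inr b : B.CStar)).comp (CTensor.inl : _ →⋆ₐ[ℂ] B.CStar).toAlgHom.toLinearMap) := by
    refine Submodule.span_le.2 ?_
    rintro _ ⟨μ, ν, h, rfl⟩
    exact h1 b hb μ ν h
  exact this ha

theorem dense_MB : Dense (B.MB : Set B.CStar) := by
  have h : Submodule.span ℂ {x : B.CStar | ∃ a b, x = CTensor.inl a * CTensor.inr b} ≤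
      B.MB.topologicalClosure := by
    refine Submodule.span_le.2 ?_
    rintro _ ⟨a, b, rfl⟩
    exact map_mem_closure₂ (f := fun a b => (CTensor.inl a * CTensor.inr b : B.CStar))
      ((CTensor.continuous_inl.comp continuous_fst).mul
        (CTensor.continuous_inr.comp continuous_snd))
      (GraphCStar.dense_pathSpan _ a) (GraphCStar.dense_pathSpan _ b)
      fun a ha b hb => B.tensor_mem_MB ha hb
  exact dense_closure.1 (CTensor.dense_span_tensors.mono h)

end OrientedCW

/-! ### Partial isometries given by partial bijections of a basis -/

section PartialBijection

/-- The space `ℓ²(ℕ)` on which `Op` acts. -/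
abbrev L2 : Type := lp (fun _ : ℕ => ℂ) 2

variable {I : Type*} (enc : I ≃ ℕ)

/-- The coordinates of the vector `pushOp enc f x`. -/
def pushFun (f : I ≃. I) (x : ℕ → ℂ) (n : ℕ) : ℂ :=
  (f.symm (enc.symm n)).elim 0 fun i => x (enc i)

/-- Partial sums of `‖pushOp enc f x‖²` are sums over distinct coordinates of `x`, since `f.symm`
is injective where it is defined. -/
theorem sum_pushFun_le (f : I ≃. I) (x : L2) (s : Finset ℕ) :
    ∑ n ∈ s, ‖pushFun enc f x n‖ ^ (2 : ℝ≥0∞).toReal ≤ ‖x‖ ^ (2 : ℝ≥0∞).toReal := by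
  classical
  let p : ℕ → ℕ := fun n => (f.symm (enc.symm n)).elim 0 enc
  let t := s.filter fun n => (f.symm (enc.symm n)).isSome
  have h1 : ∑ n ∈ s, ‖pushFun enc f x n‖ ^ (2 : ℝ≥0∞).toReal =
      ∑ n ∈ t, ‖x (p n)‖ ^ (2 : ℝ≥0∞).toReal := by
    rw [Finset.sum_filter]
    refine Finset.sum_congr rfl fun n _ => ?_
    cases h : f.symm (enc.symm n) <;> simp [pushFun, p, h]
  have hinj : Set.InjOn p t := by
    intro m hm n hn hmn
    have hm' := (Finset.mem_filter.1 hm).2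
    have hn' := (Finset.mem_filter.1 hn).2
    obtain ⟨i, hi⟩ := Option.isSome_iff_exists.1 hm'
    obtain ⟨j, hj⟩ := Option.isSome_iff_exists.1 hn'
    simp only [p, hi, hj, Option.elim, EmbeddingLike.apply_eq_iff_eq] at hmn
    subst hmn
    exact enc.symm.injective (f.symm.inj hi hj)
  rw [h1, ← Finset.sum_image (f := fun n => ‖x n‖ ^ (2 : ℝ≥0∞).toReal) hinj]
  exact lp.sum_rpow_le_norm_rpow (by simp) x _

/-- The partial isometry of `ℓ²(ℕ)` that maps the basis vector with label `i : I` to the one with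
label `f i`, or to `0` if `f i` is undefined. -/
def pushOp (f : I ≃. I) : Op :=
  LinearMap.mkContinuous
    { toFun := fun x : L2 => (⟨pushFun enc f x, memℓp_gen' (sum_pushFun_le enc f x)⟩ : L2)
      map_add' := fun x y => lp.ext <| funext fun n => by
        change pushFun enc f (x + y : L2) n = pushFun enc f x n + pushFun enc f y n
        cases h : f.symm (enc.symm n) <;> simp [pushFun, h]
      map_smul' := fun c x => lp.ext <| funext fun n => by
        change pushFun enc f (c • x : L2) n = c • pushFun enc f x n
        cases h : f.symm (enc.symm n) <;> simp [pushFun, h] }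
    1 fun x => by
      rw [one_mul]
      exact lp.norm_le_of_forall_sum_le (by simp) (norm_nonneg x) (sum_pushFun_le enc f x)

theorem pushOp_apply (f : I ≃. I) (x : L2) (n : ℕ) :
    pushOp enc f x n = (f.symm (enc.symm n)).elim 0 fun i => x (enc i) := rfl

theorem op_ext {a b : Op} (h : ∀ (x : L2) (i : I), a x (enc i) = b x (enc i)) : a = b := by
  refine ContinuousLinearMap.ext fun x => lp.ext <| funext fun n => ?_
  simpa using h x (enc.symm n)

theorem pushOp_mul (f g : I ≃. I) : pushOp enc f * pushOp enc g = pushOp enc (g.trans f) := by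
  refine op_ext enc fun x i => ?_
  rw [mul_apply_eq_comp, pushOp_apply, pushOp_apply, PEquiv.symm_trans_rev,
    Equiv.symm_apply_apply]
  change _ = ((f.symm i).bind g.symm).elim 0 _
  cases h : f.symm i with
  | none => rfl
  | some j => simp [pushOp_apply]

theorem pushOp_refl : pushOp enc (PEquiv.refl I) = 1 := by
  refine op_ext enc fun x i => ?_
  simp [pushOp_apply]

theorem star_pushOp (f : I ≃. I) : star (pushOp enc f) = pushOp enc f.symm := by
  rw [ContinuousLinearMap.star_eq_adjoint]
  symm
  rw [ContinuousLinearMap.eq_adjoint_iff]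
  intro x y
  rw [lp.inner_eq_tsum, lp.inner_eq_tsum]
  let p : ℕ → ℕ := fun n => (f.symm (enc.symm n)).elim 0 enc
  have hp : ∀ n i, f.symm (enc.symm n) = some i → p n = enc i := fun n i h => by simp [p, h]
  set u : ℕ → ℂ := fun n => inner ℂ (x n) (pushOp enc f y n) with hu
  have hsup : ∀ n : Function.support u, ∃ i, f.symm (enc.symm n) = some i := by
    rintro ⟨n, hn⟩
    cases h : f.symm (enc.symm n) with
    | none => exact absurd (by simp [hu, pushOp_apply, h]) hn
    | some i => exact ⟨i, rfl⟩
  refine tsum_eq_tsum_of_ne_zero_bij (fun n : Function.support u => p n) ?_ ?_ ?_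
  · intro m n hmn
    obtain ⟨i, hi⟩ := hsup m
    obtain ⟨j, hj⟩ := hsup n
    have hij : enc i = enc j := (hp _ _ hi).symm.trans (hmn.trans (hp _ _ hj))
    obtain rfl := enc.injective hij
    exact Subtype.ext (enc.symm.injective (f.symm.inj hi hj))
  · intro m hm
    cases h : f (enc.symm m) with
    | none => exact absurd (by simp [pushOp_apply, h]) hm
    | some j =>
      have hj : f.symm j = some (enc.symm m) := f.eq_some_iff.2 h
      have hval : u (enc j) = inner ℂ (x (enc j)) (y m) := by simp [hu, pushOp_apply, hj]
      have hne : u (enc j) ≠ 0 := by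
        rw [hval]
        simpa [pushOp_apply, h] using hm
      exact ⟨⟨enc j, hne⟩, by simp [p, hj]⟩
  · intro n
    obtain ⟨i, hi⟩ := hsup n
    have hi' : f i = some (enc.symm n) := f.eq_some_iff.1 hi
    rw [hp _ _ hi]
    simp [pushOp_apply, hi, hi']

/-- The basis vector with label `i`. -/
def basisVec (i : I) : L2 := lp.single 2 (enc i) 1

theorem inner_basisVec (i : I) (x : L2) : inner ℂ (basisVec enc i) x = x (enc i) := by
  simp [basisVec, lp.inner_single_left]

theorem norm_basisVec (i : I) : ‖basisVec enc i‖ = 1 := by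
  simp [basisVec, lp.norm_single]

open Classical in
theorem inner_basisVec_pushOp (f : I ≃. I) (i : I) :
    inner ℂ (basisVec enc i) (pushOp enc f (basisVec enc i)) = if f i = some i then 1 else 0 := by
  rw [inner_basisVec, pushOp_apply, Equiv.symm_apply_apply]
  have hiff : f i = some i ↔ f.symm i = some i := f.eq_some_iff.symm
  rw [if_congr hiff rfl rfl]
  cases h : f.symm i with
  | none => simp
  | some j =>
    by_cases hj : j = i
    · simp [hj, basisVec]
    · have : enc j ≠ enc i := fun h => hj (enc.injective h)
      simp [hj, basisVec, this]

/-- The partial bijection `f × id`. -/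
def fstLift {I : Type*} (J : Type*) (f : I ≃. I) : I × J ≃. I × J where
  toFun p := (f p.1).map fun i => (i, p.2)
  invFun p := (f.symm p.1).map fun i => (i, p.2)
  inv p q := by
    obtain ⟨i, j⟩ := p
    obtain ⟨i', j'⟩ := q
    simp only [Option.map_eq_some_iff, Prod.mk.injEq]
    constructor
    · rintro ⟨a, h, rfl, rfl⟩; exact ⟨i', f.eq_some_iff.1 h, rfl, rfl⟩
    · rintro ⟨a, h, rfl, rfl⟩; exact ⟨i, f.eq_some_iff.2 h, rfl, rfl⟩

/-- The partial bijection `id × f`. -/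
def sndLift (I : Type*) {J : Type*} (f : J ≃. J) : I × J ≃. I × J where
  toFun p := (f p.2).map fun j => (p.1, j)
  invFun p := (f.symm p.2).map fun j => (p.1, j)
  inv p q := by
    obtain ⟨i, j⟩ := p
    obtain ⟨i', j'⟩ := q
    simp only [Option.map_eq_some_iff, Prod.mk.injEq]
    constructor
    · rintro ⟨a, h, rfl, rfl⟩; exact ⟨j', f.eq_some_iff.1 h, rfl, rfl⟩
    · rintro ⟨a, h, rfl, rfl⟩; exact ⟨j, f.eq_some_iff.2 h, rfl, rfl⟩

theorem fstLift_apply {I J : Type*} (f : I ≃. I) (p : I × J) :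
    fstLift J f p = (f p.1).map fun i => (i, p.2) := rfl

theorem sndLift_apply {I J : Type*} (f : J ≃. J) (p : I × J) :
    sndLift I f p = (f p.2).map fun j => (p.1, j) := rfl

theorem fstLift_symm {I J : Type*} (f : I ≃. I) : (fstLift J f).symm = fstLift J f.symm := rfl

theorem sndLift_symm {I J : Type*} (f : J ≃. J) : (sndLift I f).symm = sndLift I f.symm := rfl

theorem fstLift_trans {I J : Type*} (f g : I ≃. I) :
    fstLift J (f.trans g) = (fstLift J f).trans (fstLift J g) := by
  refine PEquiv.ext fun p => ?_
  change ((f p.1).bind g).map _ = ((f p.1).map _).bind _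
  cases f p.1 <;> rfl

theorem sndLift_trans {I J : Type*} (f g : J ≃. J) :
    sndLift I (f.trans g) = (sndLift I f).trans (sndLift I g) := by
  refine PEquiv.ext fun p => ?_
  change ((f p.2).bind g).map _ = ((f p.2).map _).bind _
  cases f p.2 <;> rfl

theorem fstLift_trans_sndLift {I J : Type*} (f : I ≃. I) (g : J ≃. J) :
    (fstLift J f).trans (sndLift I g) = (sndLift I g).trans (fstLift J f) := by
  refine PEquiv.ext fun p => ?_
  change ((f p.1).map _).bind _ = ((g p.2).map _).bind _
  cases hf : f p.1 <;> cases hg : g p.2 <;> simp [fstLift_apply, sndLift_apply, hf, hg]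

theorem fstLift_trans_sndLift_eq_some_self {I J : Type*} (f : I ≃. I) (g : J ≃. J) (i : I) (j : J) :
    (fstLift J f).trans (sndLift I g) (i, j) = some (i, j) ↔ f i = some i ∧ g j = some j := by
  change ((f i).map _).bind _ = _ ↔ _
  cases hf : f i <;> cases hg : g j <;> simp [sndLift_apply, hg]

end PartialBijection

/-! ### Branching systems -/

/-- A branching system: vertices and edges of `G` act on the set `I` by subsets `{src = v}` and by
partial bijections `pre e` from `{src = r e}` into `{src = s e}` with disjoint ranges, which cover
`{src = v}` for every `v` that is not a sink. -/
structure Branching {V E : Type*} (G : DirGraph V E) (I : Type*) where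
  src : I → V
  pre : E → I ≃. I
  dom : ∀ e i, (pre e i).isSome ↔ src i = G.r e
  range : ∀ e i, ((pre e).symm i).isSome → src i = G.s e
  disj : ∀ e e' i, ((pre e).symm i).isSome → ((pre e').symm i).isSome → e = e'
  cover : ∀ i, ¬ G.IsSink (src i) → ∃ e, ((pre e).symm i).isSome

namespace Branching

variable {V E : Type*} {G : DirGraph V E} {I J : Type*}

/-- The action of a branching system on the first factor of a product. -/
def fst (b : Branching G I) (J : Type*) : Branching G (I × J) where
  src p := b.src p.1
  pre e := fstLift J (b.pre e)
  dom e p := by rw [fstLift_apply, Option.isSome_map]; exact b.dom e p.1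
  range e p h := by rw [fstLift_symm, fstLift_apply, Option.isSome_map] at h; exact b.range e p.1 h
  disj e e' p h h' := by
    rw [fstLift_symm, fstLift_apply, Option.isSome_map] at h h'; exact b.disj e e' p.1 h h'
  cover p hp := by
    obtain ⟨e, he⟩ := b.cover p.1 hp
    exact ⟨e, by rwa [fstLift_symm, fstLift_apply, Option.isSome_map]⟩

/-- The action of a branching system on the second factor of a product. -/
def snd (b : Branching G J) (I : Type*) : Branching G (I × J) where
  src p := b.src p.2
  pre e := sndLift I (b.pre e)
  dom e p := by rw [sndLift_apply, Option.isSome_map]; exact b.dom e p.2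
  range e p h := by rw [sndLift_symm, sndLift_apply, Option.isSome_map] at h; exact b.range e p.2 h
  disj e e' p h h' := by
    rw [sndLift_symm, sndLift_apply, Option.isSome_map] at h h'; exact b.disj e e' p.2 h h'
  cover p hp := by
    obtain ⟨e, he⟩ := b.cover p.2 hp
    exact ⟨e, by rwa [sndLift_symm, sndLift_apply, Option.isSome_map]⟩

open Classical in
/-- The identity of `{src = v}`. -/
def vert (b : Branching G I) (v : V) : I ≃. I := PEquiv.ofSet {i | b.src i = v}

theorem vert_apply [DecidableEq V] (b : Branching G I) (v : V) (i : I) :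
    b.vert v i = if b.src i = v then some i else none := by
  classical
  by_cases h : b.src i = v
  · rw [if_pos h]; exact if_pos h
  · rw [if_neg h]; exact if_neg h

theorem fst_vert (b : Branching G I) (v : V) : (b.fst J).vert v = fstLift J (b.vert v) := by
  classical
  refine PEquiv.ext fun p => ?_
  rw [vert_apply, fstLift_apply, vert_apply]
  by_cases h : b.src p.1 = v
  · rw [if_pos h, if_pos (show (b.fst J).src p = v from h)]; rfl
  · rw [if_neg h, if_neg (show ¬ (b.fst J).src p = v from h)]; rfl

theorem snd_vert (b : Branching G J) (v : V) : (b.snd I).vert v = sndLift I (b.vert v) := by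
  classical
  refine PEquiv.ext fun p => ?_
  rw [vert_apply, sndLift_apply, vert_apply]
  by_cases h : b.src p.2 = v
  · rw [if_pos h, if_pos (show (b.snd I).src p = v from h)]; rfl
  · rw [if_neg h, if_neg (show ¬ (b.snd I).src p = v from h)]; rfl

/-- The Cuntz-Krieger family on `ℓ²(ℕ)` of a branching system on a countably infinite set. -/
def family [Fintype V] [Fintype E] (b : Branching G I) (enc : I ≃ ℕ) : G.CKFamily Op where
  P v := pushOp enc (b.vert v)
  S e := pushOp enc (b.pre e)
  proj v := by
    classical
    refine ⟨?_, ?_⟩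
    · rw [IsIdempotentElem, pushOp_mul]
      congr 1
      refine PEquiv.ext fun i => ?_
      change (b.vert v i).bind _ = _
      rw [vert_apply]
      split_ifs with h
      · simp [vert_apply, h]
      · rfl
    · rw [IsSelfAdjoint, star_pushOp]; rfl
  orth v w h := by
    classical
    rw [pushOp_mul]
    refine op_ext enc fun x i => ?_
    rw [pushOp_apply, Equiv.symm_apply_apply]
    change ((b.vert v i).bind (b.vert w)).elim 0 _ = 0
    rw [vert_apply]
    split_ifs with hi
    · rw [Option.bind_some, vert_apply, if_neg fun h' => h (hi.symm.trans h')]; rfl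
    · rfl
  sum_proj := by
    classical
    refine op_ext enc fun x i => ?_
    have h : ∀ v, pushOp enc (b.vert v) x (enc i) = if b.src i = v then x (enc i) else 0 := by
      intro v
      rw [pushOp_apply, Equiv.symm_apply_apply]
      change (b.vert v i).elim 0 _ = _
      rw [vert_apply]
      split_ifs <;> rfl
    rw [sum_apply, lp.coeFn_sum, Finset.sum_apply, Finset.sum_congr rfl
      fun v _ => h v]
    simp
  star_mul e := by
    classical
    rw [star_pushOp, pushOp_mul]
    congr 1
    refine PEquiv.ext fun i => ?_
    rw [PEquiv.self_trans_symm, vert_apply]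
    change (if (b.pre e i).isSome then some i else none) = _
    exact if_congr (b.dom e i) rfl rfl
  ck v hv := by
    classical
    refine op_ext enc fun x i => ?_
    have h : ∀ e, (pushOp enc (b.pre e) * star (pushOp enc (b.pre e))) x (enc i) =
        if ((b.pre e).symm i).isSome then x (enc i) else 0 := by
      intro e
      rw [star_pushOp, pushOp_mul, pushOp_apply, Equiv.symm_apply_apply, PEquiv.symm_trans_self]
      change (if ((b.pre e).symm i).isSome then some i else none : Option I).elim 0 _ = _
      split_ifs <;> rfl
    rw [sum_apply, lp.coeFn_sum, Finset.sum_apply, Finset.sum_congr rfl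
      fun e _ => h e, pushOp_apply, Equiv.symm_apply_apply]
    change (b.vert v i).elim 0 _ = _
    rw [vert_apply]
    split_ifs with hi
    · subst hi
      obtain ⟨e, he⟩ := b.cover i hv
      rw [Finset.sum_eq_single_of_mem e (by simp [b.range e i he]), if_pos he]
      · rfl
      · intro e' _ hne
        exact if_neg fun h' => hne (b.disj e' e i h' he)
    · symm
      refine Finset.sum_eq_zero fun e he => if_neg fun h' => hi ?_
      rw [b.range e i h', (Finset.mem_filter.1 he).2]

/-- The partial bijection by which `S_{e₁} ⋯ S_{eₙ}` acts. -/
def preList (b : Branching G I) : List E → (I ≃. I)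
  | [] => PEquiv.refl I
  | e :: l => (preList b l).trans (b.pre e)

/-- The partial bijection by which `S_μ` acts. -/
def prePath (b : Branching G I) (μ : G.Path) : I ≃. I := (b.preList μ.edges).trans (b.vert μ.src)

/-- The partial bijection by which `S_μ S_ν*` acts. -/
def shift (b : Branching G I) (μ ν : G.Path) : I ≃. I := (b.prePath ν).symm.trans (b.prePath μ)

theorem fst_preList (b : Branching G I) (l : List E) :
    (b.fst J).preList l = fstLift J (b.preList l) := by
  induction l with
  | nil => rfl
  | cons e l ih => rw [preList, preList, fstLift_trans, ih]; rfl

theorem snd_preList (b : Branching G J) (l : List E) :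
    (b.snd I).preList l = sndLift I (b.preList l) := by
  induction l with
  | nil => rfl
  | cons e l ih => rw [preList, preList, sndLift_trans, ih]; rfl

theorem fst_shift (b : Branching G I) (μ ν : G.Path) :
    (b.fst J).shift μ ν = fstLift J (b.shift μ ν) := by
  simp only [shift, prePath, fst_preList, fst_vert, fstLift_trans, ← fstLift_symm]

theorem snd_shift (b : Branching G J) (μ ν : G.Path) :
    (b.snd I).shift μ ν = sndLift I (b.shift μ ν) := by
  simp only [shift, prePath, snd_preList, snd_vert, sndLift_trans, ← sndLift_symm]

end Branching

/-! ### Evaluation of the universal algebras in representations -/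

section Eval

variable {V E : Type*} [Fintype V] [Fintype E] {G : DirGraph V E}

/-- The representation of `C*(G)` given by a Cuntz-Krieger family on `ℓ²(ℕ)`. -/
def GraphCStar.eval (i : G.CKFamily Op) : GraphCStar G →⋆ₐ[ℂ] Op where
  toFun a := a.1 i
  map_one' := rfl
  map_mul' _ _ := rfl
  map_zero' := rfl
  map_add' _ _ := rfl
  commutes' _ := rfl
  map_star' _ := rfl

theorem GraphCStar.eval_S (i : G.CKFamily Op) (e : E) : GraphCStar.eval i (S G e) = i.S e := rfl

theorem GraphCStar.continuous_eval (i : G.CKFamily Op) : Continuous (GraphCStar.eval i) :=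
  AddMonoidHomClass.continuous_of_bound (GraphCStar.eval i) 1 fun a => by
    rw [one_mul]; exact NonUnitalStarAlgHom.norm_apply_le (GraphCStar.eval i) a

/-- An operator commutes with a representation of `C*(G)` as soon as it commutes with the images of
the generators and of their adjoints. -/
theorem GraphCStar.eval_commute (i : G.CKFamily Op) (t : Op) (hP : ∀ v, Commute (i.P v) t)
    (hS : ∀ e, Commute (i.S e) t) (hS' : ∀ e, Commute (star (i.S e)) t) (a : GraphCStar G) :
    Commute (GraphCStar.eval i a) t := by
  let M : Submodule ℂ (GraphCStar G) :=
    { carrier := {a | Commute (GraphCStar.eval i a) t}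
      add_mem' := fun {a b} ha hb => by
        change Commute _ _
        rw [map_add]; exact ha.add_left hb
      zero_mem' := by
        change Commute _ _
        rw [map_zero]; exact Commute.zero_left t
      smul_mem' := fun c a ha => by
        change Commute _ _
        rw [map_smul]; exact ha.smul_left c }
  have hd : Dense (M : Set (GraphCStar G)) := by
    refine dense_of_generators G M ?_ (fun v m hm => ?_) (fun e m hm => ?_) (fun e m hm => ?_)
    · change Commute _ _
      rw [map_one]; exact Commute.one_left t
    · change Commute _ _
      rw [map_mul]; exact (hP v).mul_left hm
    · change Commute _ _
      rw [map_mul]; exact (hS e).mul_left hm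
    · change Commute _ _
      rw [map_mul, map_star]; exact (hS' e).mul_left hm
  have hc : IsClosed (M : Set (GraphCStar G)) :=
    isClosed_eq ((continuous_eval i).mul continuous_const)
      (continuous_const.mul (continuous_eval i))
  exact (hc.closure_eq ▸ hd a : a ∈ (M : Set (GraphCStar G)))

variable {I : Type*} (b : Branching G I) (enc : I ≃ ℕ)

theorem Branching.eval_Spath (μ : G.Path) :
    GraphCStar.eval (b.family enc) (GraphCStar.Spath G μ) = pushOp enc (b.prePath μ) := by
  have h : ∀ l : List E, GraphCStar.eval (b.family enc) (l.map (GraphCStar.S G)).prod =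
      pushOp enc (b.preList l) := by
    intro l
    induction l with
    | nil => rw [List.map_nil, List.prod_nil, map_one]; exact (pushOp_refl enc).symm
    | cons e l ih =>
      rw [List.map_cons, List.prod_cons, map_mul, ih, GraphCStar.eval_S]
      exact pushOp_mul enc _ _
  rw [GraphCStar.Spath, map_mul, h]
  exact pushOp_mul enc _ _

theorem Branching.eval_mul_star (μ ν : G.Path) :
    GraphCStar.eval (b.family enc) (GraphCStar.Spath G μ * star (GraphCStar.Spath G ν)) =
      pushOp enc (b.shift μ ν) := by
  rw [map_mul, map_star, b.eval_Spath, b.eval_Spath, star_pushOp, pushOp_mul]; rfl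

/-- The representation of `A ⊗ B` given by commuting representations of `A` and `B`. -/
def CTensor.eval {A B : Type*} [CStarAlgebra A] [CStarAlgebra B] (p : CommReps A B) :
    CTensor A B →⋆ₐ[ℂ] Op where
  toFun a := a.1 p
  map_one' := rfl
  map_mul' _ _ := rfl
  map_zero' := rfl
  map_add' _ _ := rfl
  commutes' _ := rfl
  map_star' _ := rfl

theorem CTensor.eval_inl {A B : Type*} [CStarAlgebra A] [CStarAlgebra B] (p : CommReps A B)
    (a : A) : CTensor.eval p (inl a) = p.1.1 a := rfl

theorem CTensor.eval_inr {A B : Type*} [CStarAlgebra A] [CStarAlgebra B] (p : CommReps A B)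
    (b : B) : CTensor.eval p (inr b) = p.1.2 b := rfl

end Eval

section Pair

variable {V E V' E' : Type*} [Fintype V] [Fintype E] [Fintype V'] [Fintype E']
  {G : DirGraph V E} {G' : DirGraph V' E'} {I J : Type*}
  (b : Branching G I) (b' : Branching G' J) (enc : I × J ≃ ℕ)

/-- The commuting representations given by branching systems on the two factors of a product. -/
def pairReps : CommReps (GraphCStar G) (GraphCStar G') :=
  ⟨(GraphCStar.eval ((b.fst J).family enc), GraphCStar.eval ((b'.snd I).family enc)), by
    have key : ∀ (f : I ≃. I) (g : J ≃. J),
        Commute (pushOp enc (fstLift J f)) (pushOp enc (sndLift I g)) := by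
      intro f g
      rw [commute_iff_eq, pushOp_mul, pushOp_mul, fstLift_trans_sndLift]
    have hP : ∀ v, (((b.fst J).family enc).P v) = pushOp enc (fstLift J (b.vert v)) := fun v => by
      rw [← Branching.fst_vert]; rfl
    have hP' : ∀ v, (((b'.snd I).family enc).P v) = pushOp enc (sndLift I (b'.vert v)) :=
      fun v => by rw [← Branching.snd_vert]; rfl
    have hS : ∀ e, (((b.fst J).family enc).S e) = pushOp enc (fstLift J (b.pre e)) := fun _ => rfl
    have hS' : ∀ e, (((b'.snd I).family enc).S e) = pushOp enc (sndLift I (b'.pre e)) :=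
      fun _ => rfl
    have h1 : ∀ (f : I ≃. I) (y : GraphCStar G'),
        Commute (pushOp enc (fstLift J f)) (GraphCStar.eval ((b'.snd I).family enc) y) := by
      intro f y
      refine (GraphCStar.eval_commute _ _ (fun v => ?_) (fun e => ?_) (fun e => ?_) y).symm
      · rw [hP']; exact (key _ _).symm
      · rw [hS']; exact (key _ _).symm
      · rw [hS', star_pushOp, sndLift_symm]; exact (key _ _).symm
    intro x y
    refine GraphCStar.eval_commute _ _ (fun v => ?_) (fun e => ?_) (fun e => ?_) x
    · rw [hP]; exact h1 _ y
    · rw [hS]; exact h1 _ y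
    · rw [hS, star_pushOp, fstLift_symm]; exact h1 _ y⟩

open Classical in
/-- The diagonal matrix coefficients of `S_μ S_ν* S_Ω S_Λ*`. -/
theorem inner_pairReps (μ ν : G.Path) (Ω Λ : G'.Path) (i : I) (j : J) :
    inner ℂ (basisVec enc (i, j)) (CTensor.eval (pairReps b b' enc)
      (CTensor.inl (GraphCStar.Spath G μ * star (GraphCStar.Spath G ν)) *
        CTensor.inr (GraphCStar.Spath G' Ω * star (GraphCStar.Spath G' Λ)))
          (basisVec enc (i, j))) =
      if b.shift μ ν i = some i ∧ b'.shift Ω Λ j = some j then 1 else 0 := by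
  rw [map_mul, CTensor.eval_inl, CTensor.eval_inr]
  have h1 : (pairReps b b' enc).1.1 (GraphCStar.Spath G μ * star (GraphCStar.Spath G ν)) =
      pushOp enc (fstLift J (b.shift μ ν)) := by
    rw [← Branching.fst_shift]; exact Branching.eval_mul_star _ _ _ _
  have h2 : (pairReps b b' enc).1.2 (GraphCStar.Spath G' Ω * star (GraphCStar.Spath G' Λ)) =
      pushOp enc (sndLift I (b'.shift Ω Λ)) := by
    rw [← Branching.snd_shift]; exact Branching.eval_mul_star _ _ _ _
  rw [h1, h2, pushOp_mul, inner_basisVec_pushOp, ← fstLift_trans_sndLift]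
  simp only [fstLift_trans_sndLift_eq_some_self]

end Pair

/-! ### Infinite paths -/

namespace DirGraph

variable {V E : Type*} (G : DirGraph V E)

/-- The edges of the graph obtained from `G` by adding a loop at every sink. -/
abbrev ExtEdge : Type _ := E ⊕ {v : V // G.IsSink v}

/-- The source map of the graph with loops at the sinks. -/
def extS : G.ExtEdge → V := Sum.elim G.s (·.1)

/-- The range map of the graph with loops at the sinks. -/
def extR : G.ExtEdge → V := Sum.elim G.r (·.1)

theorem exists_extS_eq (v : V) : ∃ e, G.extS e = v := by
  by_cases h : G.IsSink v
  · exact ⟨Sum.inr ⟨v, h⟩, rfl⟩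
  · simp only [IsSink, not_forall, not_not] at h
    obtain ⟨e, he⟩ := h
    exact ⟨Sum.inl e, he⟩

/-- A choice of an edge starting at each vertex. -/
def out (v : V) : G.ExtEdge := (G.exists_extS_eq v).choose

theorem extS_out (v : V) : G.extS (G.out v) = v := (G.exists_extS_eq v).choose_spec

/-- The infinite path from `v` along the chosen edges. -/
def follow (v : V) : ℕ → G.ExtEdge
  | 0 => G.out v
  | n + 1 => G.out (G.extR (follow v n))

variable {G} in
/-- The sequence `e, x 0, x 1, …`. -/
def consSeq (e : G.ExtEdge) (x : ℕ → G.ExtEdge) : ℕ → G.ExtEdge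
  | 0 => e
  | n + 1 => x n

variable {G} in
/-- The sequence `x 1, x 2, …`. -/
def tailSeq (x : ℕ → G.ExtEdge) : ℕ → G.ExtEdge := fun n => x (n + 1)

theorem consSeq_tailSeq (x : ℕ → G.ExtEdge) : consSeq (x 0) (tailSeq x) = x := by
  funext n; cases n <;> rfl

/-- The infinite paths that eventually follow the chosen edges. There are only countably many, and
they are stable under adding or removing a first edge. -/
def infPaths : Set (ℕ → G.ExtEdge) :=
  {x | (∀ n, G.extR (x n) = G.extS (x (n + 1))) ∧
    ∃ N, ∀ n ≥ N, x (n + 1) = G.out (G.extR (x n))}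

theorem follow_mem (v : V) : G.follow v ∈ G.infPaths :=
  ⟨fun _ => (G.extS_out _).symm, 0, fun _ _ => rfl⟩

theorem consSeq_mem {e : G.ExtEdge} {x : ℕ → G.ExtEdge} (hx : x ∈ G.infPaths)
    (h : G.extR e = G.extS (x 0)) : consSeq e x ∈ G.infPaths := by
  obtain ⟨h1, N, hN⟩ := hx
  refine ⟨fun n => ?_, N + 1, fun n hn => ?_⟩
  · cases n with
    | zero => exact h
    | succ n => exact h1 n
  · obtain ⟨m, rfl⟩ : ∃ m, n = m + 1 := ⟨n - 1, by omega⟩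
    exact hN m (by omega)

theorem tailSeq_mem {x : ℕ → G.ExtEdge} (hx : x ∈ G.infPaths) : tailSeq x ∈ G.infPaths := by
  obtain ⟨h1, N, hN⟩ := hx
  exact ⟨fun n => h1 (n + 1), N, fun n hn => hN (n + 1) (by omega)⟩

theorem countable_infPaths [Countable V] [Countable E] : G.infPaths.Countable := by
  have h : G.infPaths ⊆ ⋃ N : ℕ, {x | ∀ n ≥ N, x (n + 1) = G.out (G.extR (x n))} := by
    rintro x ⟨-, N, hN⟩
    exact Set.mem_iUnion.2 ⟨N, hN⟩
  refine Set.Countable.mono h (Set.countable_iUnion fun N => ?_)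
  refine Set.countable_of_injective_of_countable_image
    (f := fun x : ℕ → G.ExtEdge => fun i : Fin (N + 1) => x i) ?_ (Set.to_countable _)
  intro x hx y hy hxy
  funext n
  induction n with
  | zero => exact congrFun hxy 0
  | succ n ih =>
    by_cases hn : n + 1 < N + 1
    · exact congrFun hxy ⟨n + 1, hn⟩
    · rw [hx n (by omega), hy n (by omega), ih]

/-- The index set of the path representation: infinite paths with an integer that records the
degree. -/
abbrev PathIndex : Type _ := G.infPaths × ℤ

open Classical in
/-- The partial bijection `(x, k) ↦ (e x, k + 1)`. -/
def prepend (e : E) : G.PathIndex ≃. G.PathIndex where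
  toFun p := if h : G.r e = G.extS (p.1.1 0) then
    some (⟨consSeq (Sum.inl e) p.1.1, G.consSeq_mem p.1.2 h⟩, p.2 + 1) else none
  invFun p := if p.1.1 0 = Sum.inl e then some (⟨tailSeq p.1.1, G.tailSeq_mem p.1.2⟩, p.2 - 1)
    else none
  inv p q := by
    obtain ⟨⟨x, hx⟩, k⟩ := p
    obtain ⟨⟨y, hy⟩, l⟩ := q
    constructor
    · intro h
      split_ifs at h with h0
      simp only [Option.some.injEq, Prod.mk.injEq, Subtype.mk.injEq] at h h0
      obtain ⟨rfl, rfl⟩ := h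
      have h1 : G.r e = G.extS (tailSeq y 0) := by
        have := hy.1 0
        rw [h0] at this
        exact this
      rw [dif_pos h1]
      simp only [Option.some.injEq, Prod.mk.injEq, Subtype.mk.injEq]
      exact ⟨by rw [← h0, consSeq_tailSeq], by ring⟩
    · intro h
      split_ifs at h with h0
      simp only [Option.some.injEq, Prod.mk.injEq, Subtype.mk.injEq] at h
      obtain ⟨rfl, rfl⟩ := h
      refine (if_pos rfl).trans ?_
      simp only [Option.some.injEq, Prod.mk.injEq, Subtype.mk.injEq]
      exact ⟨rfl, by ring⟩

theorem prepend_symm_isSome (e : E) (p : G.PathIndex) :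
    ((G.prepend e).symm p).isSome ↔ p.1.1 0 = Sum.inl e := by
  classical
  change (if p.1.1 0 = Sum.inl e then _ else none : Option G.PathIndex).isSome ↔ _
  split_ifs with h <;> simp [h]

theorem prepend_eq_some {e : E} {p q : G.PathIndex} :
    G.prepend e p = some q ↔
      q.1.1 0 = Sum.inl e ∧ tailSeq q.1.1 = p.1.1 ∧ q.2 = p.2 + 1 := by
  classical
  rw [← (G.prepend e).eq_some_iff]
  change (if q.1.1 0 = Sum.inl e then
    some ((⟨tailSeq q.1.1, G.tailSeq_mem q.1.2⟩, q.2 - 1) : G.PathIndex) else none) = _ ↔ _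
  obtain ⟨⟨x, hx⟩, k⟩ := p
  split_ifs with h
  · simp only [Option.some.injEq, Prod.mk.injEq, Subtype.mk.injEq, h, true_and]
    refine and_congr_right fun _ => ⟨fun h => by omega, fun h => by omega⟩
  · simp [h]

/-- The branching system on infinite paths. -/
def pathBranching : Branching G G.PathIndex where
  src p := G.extS (p.1.1 0)
  pre := G.prepend
  dom e p := by
    classical
    change (if h : G.r e = G.extS (p.1.1 0) then _ else none : Option G.PathIndex).isSome ↔ _
    split_ifs with h
    · simp [h]
    · simpa using fun h' => h (Eq.symm h')
  range e p h := by
    rw [prepend_symm_isSome] at h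
    rw [h]; rfl
  disj e e' p h h' := by
    rw [prepend_symm_isSome] at h h'
    exact Sum.inl_injective (h.symm.trans h')
  cover p hp := by
    cases h : p.1.1 0 with
    | inl e => exact ⟨e, (G.prepend_symm_isSome e p).2 h⟩
    | inr v =>
      rw [h] at hp
      exact absurd v.2 hp

variable {G} in
/-- The sequence `x` starts with the edges in the list. -/
def StartsWith : List E → (ℕ → G.ExtEdge) → Prop
  | [], _ => True
  | e :: l, x => x 0 = Sum.inl e ∧ StartsWith l (tailSeq x)

theorem StartsWith.eq_of_length {l l' : List E} {x : ℕ → G.ExtEdge} (h : StartsWith l x)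
    (h' : StartsWith l' x) (hl : l.length = l'.length) : l = l' := by
  induction l generalizing l' x with
  | nil => exact (List.length_eq_zero_iff.1 hl.symm).symm
  | cons e l ih =>
    cases l' with
    | nil => cases hl
    | cons e' l' =>
      obtain rfl := Sum.inl_injective (h.1.symm.trans h'.1)
      rw [ih h.2 h'.2 (by simpa using hl)]

theorem preList_eq_some {l : List E} {p q : G.PathIndex}
    (h : G.pathBranching.preList l p = some q) : StartsWith l q.1.1 ∧ q.2 = p.2 + l.length := by
  induction l generalizing q with
  | nil =>
    obtain rfl : p = q := Option.some.inj h
    exact ⟨trivial, by simp⟩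
  | cons e l ih =>
    obtain ⟨m, hm, hq⟩ := (PEquiv.trans_eq_some _ _ _ _).1 h
    obtain ⟨h1, h2, h3⟩ := G.prepend_eq_some.1 hq
    obtain ⟨h4, h5⟩ := ih hm
    refine ⟨⟨h1, by rwa [h2]⟩, ?_⟩
    rw [h3, h5, List.length_cons]
    push_cast; ring

theorem exists_preList {l : List E} {q : G.PathIndex} (h : StartsWith l q.1.1) :
    ∃ p, G.pathBranching.preList l p = some q := by
  induction l generalizing q with
  | nil => exact ⟨q, rfl⟩
  | cons e l ih =>
    obtain ⟨p, hp⟩ := ih (q := (⟨tailSeq q.1.1, G.tailSeq_mem q.1.2⟩, q.2 - 1)) h.2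
    refine ⟨p, (PEquiv.trans_eq_some _ _ _ _).2 ⟨_, hp, G.prepend_eq_some.2 ⟨h.1, rfl, ?_⟩⟩⟩
    simp

theorem prePath_eq_some {μ : G.Path} {p q : G.PathIndex} :
    G.pathBranching.prePath μ p = some q ↔
      G.pathBranching.preList μ.edges p = some q ∧ G.extS (q.1.1 0) = μ.src := by
  classical
  rw [Branching.prePath, PEquiv.trans_eq_some]
  constructor
  · rintro ⟨m, hm, hq⟩
    obtain ⟨rfl, h⟩ := PEquiv.ofSet_eq_some_iff.1 hq
    exact ⟨hm, h⟩
  · rintro ⟨h, h'⟩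
    exact ⟨q, h, PEquiv.ofSet_eq_some_iff.2 ⟨rfl, h'⟩⟩

/-- The element `S_μ S_ν*` has a nonzero diagonal matrix coefficient at `(x, k)` only if `μ = ν`:
otherwise it changes the degree `k` or replaces an initial segment of `x` by a different one of the
same length. -/
theorem shift_eq_some_self {μ ν : G.Path} (h : μ.tgt = ν.tgt) (p : G.PathIndex) :
    G.pathBranching.shift μ ν p = some p ↔
      μ = ν ∧ G.extS (p.1.1 0) = μ.src ∧ StartsWith μ.edges p.1.1 := by
  rw [Branching.shift, PEquiv.trans_eq_some]
  constructor
  · rintro ⟨q, hq, hp⟩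
    rw [PEquiv.eq_some_iff, prePath_eq_some] at hq
    rw [prePath_eq_some] at hp
    obtain ⟨h1, h2⟩ := G.preList_eq_some hp.1
    obtain ⟨h3, h4⟩ := G.preList_eq_some hq.1
    refine ⟨?_, hp.2, h1⟩
    exact Path.ext (hp.2.symm.trans hq.2) (h1.eq_of_length G h3 (by omega)) h
  · rintro ⟨rfl, h1, h2⟩
    obtain ⟨q, hq⟩ := G.exists_preList h2
    have := G.prePath_eq_some.2 ⟨hq, h1⟩
    exact ⟨q, (PEquiv.eq_some_iff _).2 this, this⟩

end DirGraph

/-! ### Averages over the paths of a given length -/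

namespace DirGraph

section

variable {V E : Type*} (G : DirGraph V E) {lam : E → ℝ}

/-- The edge weights, extended by `1` to the loops at the sinks. -/
def extLam (lam : E → ℝ) : G.ExtEdge → ℝ := Sum.elim lam fun _ => 1

theorem extLam_nonneg (h : ∀ e, 0 ≤ lam e) (e : G.ExtEdge) : 0 ≤ G.extLam lam e := by
  cases e with
  | inl e => exact h e
  | inr v => exact zero_le_one

end

variable {V E : Type*} [Fintype V] [Fintype E] (G : DirGraph V E) (g : V → ℝ) (lam : E → ℝ)

open Classical in
/-- The sum of `lam(μ) g(r(μ)) f(μ x)` over the paths `μ` of length `N` from `v`, with `x` the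
chosen infinite path from `r(μ)`. -/
def average : ℕ → V → ((ℕ → G.ExtEdge) → ℂ) →ₗ[ℂ] ℂ
  | 0, v => (g v : ℂ) • LinearMap.proj (G.follow v)
  | N + 1, v => ∑ e with G.extS e = v, (G.extLam lam e : ℂ) •
      (average N (G.extR e)).comp (LinearMap.funLeft ℂ ℂ (consSeq e))

theorem average_zero (v : V) (f : (ℕ → G.ExtEdge) → ℂ) :
    G.average g lam 0 v f = g v * f (G.follow v) := rfl

open Classical in
theorem average_succ (N : ℕ) (v : V) (f : (ℕ → G.ExtEdge) → ℂ) :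
    G.average g lam (N + 1) v f = ∑ e with G.extS e = v, (G.extLam lam e : ℂ) *
      G.average g lam N (G.extR e) fun x => f (consSeq e x) := by
  rw [average, LinearMap.sum_apply]
  rfl

/-- The average from `v` only involves infinite paths that start at `v`. -/
theorem average_congr {f f' : (ℕ → G.ExtEdge) → ℂ} (N : ℕ) {v : V}
    (h : ∀ x ∈ G.infPaths, G.extS (x 0) = v → f x = f' x) :
    G.average g lam N v f = G.average g lam N v f' := by
  induction N generalizing v f f' with
  | zero => rw [average_zero, average_zero, h _ (G.follow_mem v) (G.extS_out v)]
  | succ N ih =>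
    classical
    rw [average_succ, average_succ]
    refine Finset.sum_congr rfl fun e he => ?_
    rw [ih fun x hx hx' => h _ (G.consSeq_mem hx hx'.symm) (Finset.mem_filter.1 he).2]

variable {g lam}

open Classical in
/-- With the loops at the sinks, the equation of a graph weight holds at every vertex. -/
theorem IsGraphWeight.ext_eq (hw : G.IsGraphWeight g lam) (v : V) :
    ∑ e with G.extS e = v, G.extLam lam e * g (G.extR e) = g v := by
  rw [Finset.sum_filter, Fintype.sum_sum_type]
  by_cases h : G.IsSink v
  · have h1 : ∀ e, (if G.extS (Sum.inl e) = v then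
        G.extLam lam (Sum.inl e) * g (G.extR (Sum.inl e)) else 0) = 0 :=
      fun e => if_neg (h e)
    rw [Finset.sum_congr rfl fun e _ => h1 e, Finset.sum_const_zero, zero_add,
      Finset.sum_eq_single_of_mem ⟨v, h⟩ (Finset.mem_univ _)]
    · refine (if_pos rfl).trans ?_
      simp [extLam, extR]
    · rintro ⟨w, hw⟩ _ hne
      exact if_neg fun h' => hne (Subtype.ext h')
  · have h1 : ∀ e : {w // G.IsSink w}, (if G.extS (Sum.inr e) = v then
        G.extLam lam (Sum.inr e) * g (G.extR (Sum.inr e)) else 0) = 0 :=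
      fun e => if_neg fun h' : e.1 = v => h (h' ▸ e.2)
    rw [Finset.sum_congr rfl fun e _ => h1 e, Finset.sum_const_zero, add_zero, hw.2.2 v h,
      Finset.sum_filter]
    rfl

theorem average_const (hw : G.IsGraphWeight g lam) (N : ℕ) (v : V) (c : ℂ) :
    G.average g lam N v (fun _ => c) = g v * c := by
  induction N generalizing v with
  | zero => rfl
  | succ N ih =>
    rw [average_succ, Finset.sum_congr rfl fun e _ => by rw [ih], ← hw.ext_eq G v]
    push_cast
    rw [Finset.sum_mul]
    exact Finset.sum_congr rfl fun e _ => by ring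

theorem average_nonneg (hw : G.IsGraphWeight g lam) (N : ℕ) (v : V)
    {f : (ℕ → G.ExtEdge) → ℂ} (hf : ∀ x, 0 ≤ f x) : 0 ≤ G.average g lam N v f := by
  induction N generalizing v f with
  | zero =>
    exact mul_nonneg (Complex.zero_le_real.2 (hw.1 v)) (hf _)
  | succ N ih =>
    rw [average_succ]
    exact Finset.sum_nonneg fun e _ =>
      mul_nonneg (Complex.zero_le_real.2 (G.extLam_nonneg hw.2.1 e)) (ih _ fun x => hf _)

theorem norm_average_le (hw : G.IsGraphWeight g lam) (N : ℕ) (v : V)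
    {f : (ℕ → G.ExtEdge) → ℂ} {C : ℝ} (hf : ∀ x, ‖f x‖ ≤ C) :
    ‖G.average g lam N v f‖ ≤ g v * C := by
  induction N generalizing v f with
  | zero =>
    rw [average_zero, norm_mul, Complex.norm_real, Real.norm_of_nonneg (hw.1 v)]
    exact mul_le_mul_of_nonneg_left (hf _) (hw.1 v)
  | succ N ih =>
    rw [average_succ, ← hw.ext_eq G v, Finset.sum_mul]
    refine norm_sum_le_of_le _ fun e _ => ?_
    rw [norm_mul, Complex.norm_real, Real.norm_of_nonneg (G.extLam_nonneg hw.2.1 e), mul_assoc]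
    exact mul_le_mul_of_nonneg_left (ih _ fun x => hf _) (G.extLam_nonneg hw.2.1 e)

open Classical in
theorem average_startsWith (hw : G.IsGraphWeight g lam) {l : List E} {v w : V}
    (hl : G.IsPath v l w) {N : ℕ} (hN : l.length ≤ N) :
    G.average g lam N v (fun x => if StartsWith l x then 1 else 0) =
      (((l.map lam).prod * g w : ℝ) : ℂ) := by
  induction l generalizing v N with
  | nil =>
    obtain rfl : v = w := hl
    have : (fun x : ℕ → G.ExtEdge => if StartsWith [] x then (1 : ℂ) else 0) = fun _ => 1 :=
      funext fun x => if_pos trivial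
    rw [this, average_const G hw]
    simp
  | cons e l ih =>
    obtain ⟨rfl, hl⟩ := hl
    obtain ⟨N, rfl⟩ : ∃ M, N = M + 1 := ⟨N - 1, by simp at hN; omega⟩
    have he : (Sum.inl e : G.ExtEdge) ∈ Finset.univ.filter fun e' => G.extS e' = G.s e :=
      Finset.mem_filter.2 ⟨Finset.mem_univ _, rfl⟩
    rw [average_succ, Finset.sum_eq_single_of_mem _ he]
    · have : (fun x : ℕ → G.ExtEdge =>
          if StartsWith (e :: l) (consSeq (Sum.inl e) x) then (1 : ℂ) else 0) =
          fun x => if StartsWith l x then 1 else 0 :=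
        funext fun x => if_congr (and_iff_right rfl) rfl rfl
      rw [this]
      have h2 := ih hl (N := N) (by simpa using hN)
      change (lam e : ℂ) * G.average g lam N (G.r e) _ = _
      rw [h2, List.map_cons, List.prod_cons]
      push_cast; ring
    · intro e' _ hne
      have : (fun x : ℕ → G.ExtEdge =>
          if StartsWith (e :: l) (consSeq e' x) then (1 : ℂ) else 0) = fun _ => 0 :=
        funext fun x => if_neg fun h => hne h.1
      rw [this, average_const G hw, mul_zero, mul_zero]

open Classical in
/-- For `N` at least the length of `μ`, the averages from all vertices together give the set of
infinite paths with initial segment `μ` the mass `lam(μ) g(r(μ))`. -/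
theorem sum_average_cylinder (hw : G.IsGraphWeight g lam) (μ : G.Path) {N : ℕ}
    (hN : μ.edges.length ≤ N) :
    ∑ v, G.average g lam N v
      (fun x => if G.extS (x 0) = μ.src ∧ StartsWith μ.edges x then 1 else 0) =
      (((μ.edges.map lam).prod * g μ.tgt : ℝ) : ℂ) := by
  rw [Finset.sum_eq_single_of_mem μ.src (Finset.mem_univ _)]
  · rw [← average_startsWith G hw μ.isPath hN]
    exact G.average_congr g lam N fun x _ hx => if_congr (and_iff_right hx) rfl rfl
  · intro v _ hv
    rw [G.average_congr g lam N (f' := fun _ => 0) fun x _ hx => if_neg fun h => hv ?_,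
      average_const G hw, mul_zero]
    exact hx.symm.trans h.1

end DirGraph

/-! ### The product state -/

section State

variable {V E V' E' : Type*} [Fintype V] [Fintype E] [Fintype V'] [Fintype E']
  (G : DirGraph V E) (G' : DirGraph V' E')

theorem exists_enc [Nonempty V] [Nonempty V'] : Nonempty (G.PathIndex × G'.PathIndex ≃ ℕ) := by
  have : Countable G.infPaths := G.countable_infPaths.to_subtype
  have : Countable G'.infPaths := G'.countable_infPaths.to_subtype
  have : Nonempty G.infPaths := ⟨⟨_, G.follow_mem (Classical.arbitrary V)⟩⟩
  have : Nonempty G'.infPaths := ⟨⟨_, G'.follow_mem (Classical.arbitrary V')⟩⟩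
  exact nonempty_equiv_of_countable

variable {G G'} (enc : G.PathIndex × G'.PathIndex ≃ ℕ)

open Classical in
/-- The basis vector with label `((x, 0), (y, 0))`, or `0` if `x` or `y` is not one of the
infinite paths under consideration. -/
def pathVec (x : ℕ → G.ExtEdge) (y : ℕ → G'.ExtEdge) : L2 :=
  if h : x ∈ G.infPaths ∧ y ∈ G'.infPaths then
    basisVec enc ((⟨x, h.1⟩, 0), (⟨y, h.2⟩, 0)) else 0

/-- The vector functional of `pathVec`. -/
def pathCoeff (x : ℕ → G.ExtEdge) (y : ℕ → G'.ExtEdge)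
    (a : CTensor (GraphCStar G) (GraphCStar G')) : ℂ :=
  inner ℂ (pathVec enc x y)
    (CTensor.eval (pairReps G.pathBranching G'.pathBranching enc) a (pathVec enc x y))

variable (x : ℕ → G.ExtEdge) (y : ℕ → G'.ExtEdge) (a b : CTensor (GraphCStar G) (GraphCStar G'))

theorem pathCoeff_add : pathCoeff enc x y (a + b) = pathCoeff enc x y a + pathCoeff enc x y b := by
  rw [pathCoeff, map_add, add_apply, inner_add_right]; rfl

theorem pathCoeff_smul (c : ℂ) : pathCoeff enc x y (c • a) = c * pathCoeff enc x y a := by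
  rw [pathCoeff, map_smul, smul_apply, inner_smul_right]; rfl

theorem pathCoeff_star_mul_self : 0 ≤ pathCoeff enc x y (star a * a) := by
  rw [pathCoeff, map_mul, map_star, mul_apply_eq_comp, ContinuousLinearMap.star_eq_adjoint,
    ContinuousLinearMap.adjoint_inner_right, inner_self_eq_norm_sq_to_K]
  rw [← RCLike.ofReal_pow]
  exact RCLike.ofReal_nonneg.2 (sq_nonneg _)

theorem norm_pathCoeff_le : ‖pathCoeff enc x y a‖ ≤ ‖a‖ := by
  have h1 : ‖pathVec enc x y‖ ≤ 1 := by
    rw [pathVec]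
    split_ifs
    · exact (norm_basisVec enc _).le
    · simp
  refine (norm_inner_le_norm _ _).trans ?_
  refine (mul_le_mul h1 (ContinuousLinearMap.le_opNorm _ _) (norm_nonneg _) zero_le_one).trans ?_
  rw [one_mul]
  refine (mul_le_of_le_one_right (norm_nonneg _) h1).trans ?_
  exact NonUnitalStarAlgHom.norm_apply_le
    (CTensor.eval (pairReps G.pathBranching G'.pathBranching enc)) a

theorem ite_and_and_and {p q r s : Prop} [Decidable ((p ∧ r) ∧ q ∧ s)] [Decidable (p ∧ q)]
    [Decidable r] [Decidable s] : (if (p ∧ r) ∧ q ∧ s then (1 : ℂ) else 0) =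
      (if p ∧ q then 1 else 0) * (if r then 1 else 0) * (if s then 1 else 0) := by
  by_cases hp : p <;> by_cases hq : q <;> by_cases hr : r <;> by_cases hs : s <;>
    simp [hp, hq, hr, hs]

open Classical in
theorem pathCoeff_monomial {μ ν : G.Path} {Ω Λ : G'.Path} (h : μ.tgt = ν.tgt) (h' : Ω.tgt = Λ.tgt)
    {x : ℕ → G.ExtEdge} {y : ℕ → G'.ExtEdge} (hx : x ∈ G.infPaths) (hy : y ∈ G'.infPaths) :
    pathCoeff enc x y (CTensor.inl (GraphCStar.Spath G μ * star (GraphCStar.Spath G ν)) *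
        CTensor.inr (GraphCStar.Spath G' Ω * star (GraphCStar.Spath G' Λ))) =
      (if μ = ν ∧ Ω = Λ then 1 else 0) *
        (if G.extS (x 0) = μ.src ∧ DirGraph.StartsWith μ.edges x then 1 else 0) *
        (if G'.extS (y 0) = Ω.src ∧ DirGraph.StartsWith Ω.edges y then 1 else 0) := by
  rw [pathCoeff, pathVec, dif_pos ⟨hx, hy⟩, inner_pairReps]
  simp only [DirGraph.shift_eq_some_self G h, DirGraph.shift_eq_some_self G' h']
  exact ite_and_and_and

variable (g : V → ℝ) (lam : E → ℝ) (g' : V' → ℝ) (lam' : E' → ℝ)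

/-- The average of the vector functionals over pairs of paths of length `N`. -/
def avgState (N : ℕ) (a : CTensor (GraphCStar G) (GraphCStar G')) : ℂ :=
  ∑ v, G.average g lam N v fun x =>
    ∑ w, G'.average g' lam' N w fun y => pathCoeff enc x y a

theorem avgState_add (N : ℕ) : avgState enc g lam g' lam' N (a + b) =
    avgState enc g lam g' lam' N a + avgState enc g lam g' lam' N b := by
  simp only [avgState, pathCoeff_add]
  rw [← Finset.sum_add_distrib]
  refine Finset.sum_congr rfl fun v _ => ?_
  rw [← map_add]
  congr 1
  funext x
  rw [Pi.add_apply, ← Finset.sum_add_distrib]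
  refine Finset.sum_congr rfl fun w _ => ?_
  rw [← map_add]
  rfl

theorem avgState_smul (c : ℂ) (N : ℕ) : avgState enc g lam g' lam' N (c • a) =
    c * avgState enc g lam g' lam' N a := by
  simp only [avgState, pathCoeff_smul]
  rw [Finset.mul_sum]
  refine Finset.sum_congr rfl fun v _ => ?_
  rw [← smul_eq_mul, ← map_smul]
  congr 1
  funext x
  rw [Pi.smul_apply, smul_eq_mul, Finset.mul_sum]
  refine Finset.sum_congr rfl fun w _ => ?_
  rw [← smul_eq_mul, ← map_smul]
  rfl

variable {g lam g' lam'}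

theorem avgState_star_mul_self (hw : G.IsGraphWeight g lam) (hw' : G'.IsGraphWeight g' lam')
    (N : ℕ) : 0 ≤ avgState enc g lam g' lam' N (star a * a) :=
  Finset.sum_nonneg fun _ _ => G.average_nonneg hw N _ fun _ => Finset.sum_nonneg fun _ _ =>
    G'.average_nonneg hw' N _ fun _ => pathCoeff_star_mul_self enc _ _ a

theorem norm_avgState_le (hw : G.IsGraphWeight g lam) (hw' : G'.IsGraphWeight g' lam') (N : ℕ) :
    ‖avgState enc g lam g' lam' N a‖ ≤ ((∑ v, g v) * ∑ w, g' w) * ‖a‖ := by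
  rw [mul_assoc, Finset.sum_mul]
  refine norm_sum_le_of_le _ fun v _ => G.norm_average_le hw N v fun x => ?_
  rw [Finset.sum_mul]
  exact norm_sum_le_of_le _ fun w _ => G'.norm_average_le hw' N w fun y =>
    norm_pathCoeff_le enc x y a

open Classical in
theorem avgState_monomial (hw : G.IsGraphWeight g lam) (hw' : G'.IsGraphWeight g' lam')
    {μ ν : G.Path} {Ω Λ : G'.Path} (h : μ.tgt = ν.tgt) (h' : Ω.tgt = Λ.tgt) {N : ℕ}
    (hN : μ.edges.length ≤ N) (hN' : Ω.edges.length ≤ N) :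
    avgState enc g lam g' lam' N
      (CTensor.inl (GraphCStar.Spath G μ * star (GraphCStar.Spath G ν)) *
        CTensor.inr (GraphCStar.Spath G' Ω * star (GraphCStar.Spath G' Λ))) =
      if μ = ν ∧ Ω = Λ then (((μ.edges.map lam).prod * g μ.tgt *
        ((Ω.edges.map lam').prod * g' Ω.tgt) : ℝ) : ℂ) else 0 := by
  set m := (CTensor.inl (GraphCStar.Spath G μ * star (GraphCStar.Spath G ν)) *
        CTensor.inr (GraphCStar.Spath G' Ω * star (GraphCStar.Spath G' Λ))) with hm
  set f : (ℕ → G.ExtEdge) → ℂ := fun x =>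
    if G.extS (x 0) = μ.src ∧ DirGraph.StartsWith μ.edges x then 1 else 0 with hf
  set f' : (ℕ → G'.ExtEdge) → ℂ := fun y =>
    if G'.extS (y 0) = Ω.src ∧ DirGraph.StartsWith Ω.edges y then 1 else 0 with hf'
  set d : ℂ := if μ = ν ∧ Ω = Λ then 1 else 0 with hd
  have h1 : ∀ x ∈ G.infPaths, ∀ y ∈ G'.infPaths, pathCoeff enc x y m = (d * f x) * f' y := by
    intro x hx y hy
    rw [hm, pathCoeff_monomial enc h h' hx hy]
  have h2 : ∀ x ∈ G.infPaths, ∑ w, G'.average g' lam' N w (fun y => pathCoeff enc x y m) =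
      (d * (((Ω.edges.map lam').prod * g' Ω.tgt : ℝ) : ℂ)) * f x := by
    intro x hx
    rw [← DirGraph.sum_average_cylinder G' hw' Ω hN', mul_right_comm, Finset.mul_sum]
    refine Finset.sum_congr rfl fun w _ => ?_
    rw [G'.average_congr g' lam' N (f' := (d * f x) • f') fun y hy _ => h1 x hx y hy, map_smul]
    rfl
  have h3 : avgState enc g lam g' lam' N m =
      (d * (((Ω.edges.map lam').prod * g' Ω.tgt : ℝ) : ℂ)) *
        (((μ.edges.map lam).prod * g μ.tgt : ℝ) : ℂ) := by
    rw [← DirGraph.sum_average_cylinder G hw μ hN, Finset.mul_sum]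
    refine Finset.sum_congr rfl fun v _ => ?_
    rw [G.average_congr g lam N
      (f' := (d * (((Ω.edges.map lam').prod * g' Ω.tgt : ℝ) : ℂ)) • f) fun x hx _ => h2 x hx,
      map_smul]
    rfl
  rw [h3, hd]
  split_ifs
  · push_cast; ring
  · rw [zero_mul, zero_mul]

open Filter Topology in
open Classical in
/-- The positive functional with the prescribed values on `S_μ S_ν* S_Ω S_Λ*`. It is a limit along
an ultrafilter of the functionals `avgState`, whose values on each of these elements are eventually
constant. -/
theorem exists_productState [Nonempty V] [Nonempty V'] (hw : G.IsGraphWeight g lam)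
    (hw' : G'.IsGraphWeight g' lam') :
    ∃ φ : CTensor (GraphCStar G) (GraphCStar G') →L[ℂ] ℂ, (∀ a, 0 ≤ φ (star a * a)) ∧
      ∀ (μ ν : G.Path) (Ω Λ : G'.Path), μ.tgt = ν.tgt → Ω.tgt = Λ.tgt →
        φ (CTensor.inl (GraphCStar.Spath G μ * star (GraphCStar.Spath G ν)) *
          CTensor.inr (GraphCStar.Spath G' Ω * star (GraphCStar.Spath G' Λ))) =
        if μ = ν ∧ Ω = Λ then (((μ.edges.map lam).prod * g μ.tgt *
          ((Ω.edges.map lam').prod * g' Ω.tgt) : ℝ) : ℂ) else 0 := by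
  obtain ⟨enc⟩ := exists_enc G G'
  let C := (∑ v, g v) * ∑ w, g' w
  let Φ := fun (a : CTensor (GraphCStar G) (GraphCStar G')) N => avgState enc g lam g' lam' N a
  have hlim : ∀ a, ∃ z : ℂ, ‖z‖ ≤ C * ‖a‖ ∧ Tendsto (Φ a) (hyperfilter ℕ) (𝓝 z) := by
    intro a
    have hb : ∀ N, Φ a N ∈ Metric.closedBall (0 : ℂ) (C * ‖a‖) := fun N =>
      mem_closedBall_zero_iff.2 (norm_avgState_le enc a hw hw' N)
    obtain ⟨z, hz, hz'⟩ := (isCompact_closedBall (0 : ℂ) (C * ‖a‖)).ultrafilter_le_nhds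
      ((hyperfilter ℕ).map (Φ a)) (le_principal_iff.2 (mem_map.2 (Eventually.of_forall hb)))
    exact ⟨z, mem_closedBall_zero_iff.1 hz, hz'⟩
  choose φ hφ hlim using hlim
  have hadd : ∀ a b, φ (a + b) = φ a + φ b := fun a b => by
    refine tendsto_nhds_unique (hlim (a + b)) (((hlim a).add (hlim b)).congr fun N => ?_)
    exact (avgState_add enc a b g lam g' lam' N).symm
  have hsmul : ∀ (c : ℂ) a, φ (c • a) = c • φ a := fun c a => by
    refine tendsto_nhds_unique (hlim (c • a)) (((hlim a).const_mul c).congr fun N => ?_)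
    exact (avgState_smul enc a g lam g' lam' c N).symm
  refine ⟨LinearMap.mkContinuous ⟨⟨φ, hadd⟩, hsmul⟩ C hφ, fun a => ?_, ?_⟩
  · exact ge_of_tendsto' (hlim (star a * a)) fun N => avgState_star_mul_self enc a hw hw' N
  · intro μ ν Ω Λ h h'
    refine tendsto_nhds_unique (hlim _) (Tendsto.congr' ?_ tendsto_const_nhds)
    have hev : ∀ᶠ N in (hyperfilter ℕ : Filter ℕ), max μ.edges.length Ω.edges.length ≤ N :=
      Nat.hyperfilter_le_atTop (eventually_ge_atTop _)
    filter_upwards [hev] with N hN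
    exact (avgState_monomial enc hw hw' h h' ((le_max_left _ _).trans hN)
      ((le_max_right _ _).trans hN)).symm

/-- The elements `P_v ⊗ P_w` are nonzero. -/
theorem inl_P_mul_inr_P_ne_zero (v : V) (w : V') :
    (CTensor.inl (GraphCStar.P G v) * CTensor.inr (GraphCStar.P G' w) :
      CTensor (GraphCStar G) (GraphCStar G')) ≠ 0 := by
  have : Nonempty V := ⟨v⟩
  have : Nonempty V' := ⟨w⟩
  obtain ⟨enc⟩ := exists_enc G G'
  intro h
  have h1 := pathCoeff_monomial enc (μ := .nil G v) (ν := .nil G v) (Ω := .nil G' w)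
    (Λ := .nil G' w) rfl rfl (G.follow_mem v) (G'.follow_mem w)
  rw [GraphCStar.Spath_nil, GraphCStar.Spath_nil, GraphCStar.star_P, GraphCStar.star_P,
    GraphCStar.P_mul_P_self, GraphCStar.P_mul_P_self, h, if_pos ⟨rfl, rfl⟩,
    if_pos ⟨G.extS_out v, trivial⟩, if_pos ⟨G'.extS_out w, trivial⟩, pathCoeff, map_zero] at h1
  simp at h1

end State

/-! ### The KMS condition from eigenvectors of the time evolution -/

section KMS

variable {A : Type*} [CStarAlgebra A] (φ : A →L[ℂ] ℂ) (σ : ℝ → (A ≃⋆ₐ[ℂ] A))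

/-- `x` is an eigenvector of the time evolution, `σ_t x = exp(i s t) x`, for which moving `x` from
the left to the right inside `φ` costs the factor `exp s`. -/
def IsEigen (x : A) (s : ℝ) : Prop :=
  (∀ t : ℝ, σ t x = Complex.exp (Complex.I * s * t) • x) ∧
    ∀ y, φ (x * y) = Complex.exp s * φ (y * x)

variable {φ σ}

theorem IsEigen.mul {x y : A} {s s' : ℝ} (hx : IsEigen φ σ x s) (hy : IsEigen φ σ y s') :
    IsEigen φ σ (x * y) (s + s') := by
  constructor
  · intro t
    rw [map_mul, hx.1, hy.1, smul_mul_smul_comm, ← Complex.exp_add]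
    congr 2
    push_cast; ring
  · intro a
    rw [mul_assoc, hx.2, mul_assoc, hy.2, Complex.ofReal_add, Complex.exp_add, mul_assoc,
      mul_assoc]

/-- A positive functional is hermitian, by positivity at `1`, `a`, `1 + a` and `1 + i a`. -/
theorem map_star_of_nonneg (hφ : ∀ a, 0 ≤ φ (star a * a)) (a : A) :
    φ (star a) = star (φ a) := by
  have h0 := (Complex.nonneg_iff.1 (hφ 1)).2
  have h1 := (Complex.nonneg_iff.1 (hφ a)).2
  have h2 := (Complex.nonneg_iff.1 (hφ (1 + a))).2
  have h3 := (Complex.nonneg_iff.1 (hφ (1 + Complex.I • a))).2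
  have e2 : star (1 + a) * (1 + a) = star (1 : A) * 1 + a + star a + star a * a := by
    rw [star_add, star_one]; noncomm_ring
  have e3 : star (1 + Complex.I • a) * (1 + Complex.I • a) =
      star (1 : A) * 1 + Complex.I • a - Complex.I • star a + star a * a := by
    rw [star_add, star_one, star_smul, Complex.star_def, Complex.conj_I, add_mul, mul_add, mul_add,
      smul_mul_smul_comm]
    simp only [mul_one, one_mul, neg_mul, Complex.I_mul_I, neg_neg, one_smul, neg_smul]
    abel
  rw [e2] at h2
  rw [e3] at h3
  simp only [map_add, map_sub, map_smul, Complex.add_im, Complex.sub_im, smul_eq_mul,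
    Complex.mul_im, Complex.I_re, Complex.I_im, zero_mul, one_mul, zero_add] at h2 h3
  apply Complex.ext
  · rw [Complex.star_def, Complex.conj_re]; linarith
  · rw [Complex.star_def, Complex.conj_im]; linarith

theorem IsEigen.star (hφ : ∀ a, 0 ≤ φ (star a * a)) {x : A} {s : ℝ} (hx : IsEigen φ σ x s) :
    IsEigen φ σ (star x) (-s) := by
  constructor
  · intro t
    rw [map_star, hx.1, star_smul, Complex.star_def, ← Complex.exp_conj]
    simp
  · intro y
    have h := congrArg Star.star (hx.2 (Star.star y))
    rw [← map_star_of_nonneg hφ, StarMul.star_mul, star_star, StarMul.star_mul,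
      ← map_star_of_nonneg hφ, StarMul.star_mul, star_star, Complex.star_def,
      ← Complex.exp_conj, Complex.conj_ofReal] at h
    rw [Complex.ofReal_neg, Complex.exp_neg, eq_inv_mul_iff_mul_eq₀ (Complex.exp_ne_zero _),
      h, mul_comm]

theorem norm_autom_le (t : ℝ) (x : A) : ‖σ t x‖ ≤ ‖x‖ := NonUnitalStarAlgHom.norm_apply_le (σ t) x

variable (φ σ) in
/-- The subspace spanned by the eigenvectors. -/
def eigenSpan : Submodule ℂ A := Submodule.span ℂ {x | ∃ s, IsEigen φ σ x s}

/-- On eigenvectors the time evolution is visibly continuous, and by isometry it is so on the closure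
of their span. -/
theorem continuous_evolution (hd : Dense (eigenSpan φ σ : Set A)) (a : A) :
    Continuous fun t => σ t a := by
  have h1 : ∀ x ∈ eigenSpan φ σ, Continuous fun t => σ t x := by
    intro x hx
    induction hx using Submodule.span_induction with
    | mem x hx =>
      obtain ⟨s, hs⟩ := hx
      simp only [hs.1]
      fun_prop
    | zero => simp only [map_zero]; exact continuous_const
    | add x y _ _ hx hy => simp only [map_add]; exact hx.add hy
    | smul c x _ hx => simp only [map_smul]; exact hx.const_smul c
  refine continuous_of_uniform_approx_of_continuous fun u hu => ?_
  obtain ⟨ε, hε, hu⟩ := Metric.mem_uniformity_dist.1 hu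
  obtain ⟨x, hx, hxa⟩ := Metric.dense_iff.1 hd a ε hε
  refine ⟨fun t => σ t x, h1 x hxa, fun t => hu ?_⟩
  rw [dist_eq_norm, ← map_sub]
  refine (norm_autom_le t _).trans_lt ?_
  rw [← dist_eq_norm, dist_comm]
  exact hx

variable (φ σ) in
/-- `F` is the function on the strip `0 ≤ Im z ≤ 1` that the KMS condition requires for `x`
and `y`. -/
structure IsStripFun (x y : A) (F : ℂ → ℂ) : Prop where
  diff : DifferentiableOn ℂ F {z | 0 < z.im ∧ z.im < 1}
  cont : ContinuousOn F {z | 0 ≤ z.im ∧ z.im ≤ 1}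
  bdd : ∃ C : ℝ, ∀ z : ℂ, 0 ≤ z.im → z.im ≤ 1 → ‖F z‖ ≤ C
  lower : ∀ t : ℝ, F t = φ (σ t x * y)
  upper : ∀ t : ℝ, F (t + Complex.I) = φ (y * σ t x)

theorem IsStripFun.add {x x' y : A} {F F' : ℂ → ℂ} (h : IsStripFun φ σ x y F)
    (h' : IsStripFun φ σ x' y F') : IsStripFun φ σ (x + x') y fun z => F z + F' z where
  diff := h.diff.add h'.diff
  cont := h.cont.add h'.cont
  bdd := by
    obtain ⟨C, hC⟩ := h.bdd
    obtain ⟨C', hC'⟩ := h'.bdd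
    exact ⟨C + C', fun z h0 h1 => (norm_add_le _ _).trans (add_le_add (hC z h0 h1) (hC' z h0 h1))⟩
  lower t := by rw [h.lower, h'.lower, map_add, add_mul, map_add]
  upper t := by rw [h.upper, h'.upper, map_add, mul_add, map_add]

theorem IsStripFun.smul (c : ℂ) {x y : A} {F : ℂ → ℂ} (h : IsStripFun φ σ x y F) :
    IsStripFun φ σ (c • x) y fun z => c * F z where
  diff := h.diff.const_mul c
  cont := continuousOn_const.mul h.cont
  bdd := by
    obtain ⟨C, hC⟩ := h.bdd
    refine ⟨‖c‖ * C, fun z h0 h1 => ?_⟩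
    rw [norm_mul]
    exact mul_le_mul_of_nonneg_left (hC z h0 h1) (norm_nonneg c)
  lower t := by rw [h.lower, map_smul, smul_mul_assoc, map_smul, smul_eq_mul]
  upper t := by rw [h.upper, map_smul, mul_smul_comm, map_smul, smul_eq_mul]

theorem IsStripFun.sub {x x' y : A} {F F' : ℂ → ℂ} (h : IsStripFun φ σ x y F)
    (h' : IsStripFun φ σ x' y F') : IsStripFun φ σ (x - x') y fun z => F z - F' z := by
  have := h.add (h'.smul (-1))
  simpa only [neg_one_smul, neg_one_mul, ← sub_eq_add_neg] using this

/-- By the Phragmén-Lindelöf principle, the bounds on the two boundary lines hold on the strip. -/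
theorem IsStripFun.norm_le {x y : A} {F : ℂ → ℂ} (h : IsStripFun φ σ x y F) {z : ℂ}
    (h0 : 0 ≤ z.im) (h1 : z.im ≤ 1) : ‖F z‖ ≤ ‖φ‖ * (‖x‖ * ‖y‖) := by
  have hmul : ∀ t : ℝ, ‖σ t x‖ * ‖y‖ ≤ ‖x‖ * ‖y‖ := fun t =>
    mul_le_mul_of_nonneg_right (norm_autom_le t x) (norm_nonneg y)
  refine PhragmenLindelof.horizontal_strip (a := 0) (b := 1) (f := F) ⟨h.diff, ?_⟩
    ⟨0, ?_, 0, ?_⟩ ?_ ?_ h0 h1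
  · rw [Complex.closure_preimage_im, closure_Ioo zero_ne_one]
    exact h.cont
  · rw [sub_zero, div_one]; exact Real.pi_pos
  · obtain ⟨C, hC⟩ := h.bdd
    refine Asymptotics.IsBigO.of_bound C ?_
    have hev : ∀ᶠ z in Filter.comap (abs ∘ Complex.re) Filter.atTop ⊓
        Filter.principal (Complex.im ⁻¹' Set.Ioo 0 1), z ∈ Complex.im ⁻¹' Set.Ioo (0 : ℝ) 1 :=
      Filter.mem_inf_of_right (Filter.mem_principal_self _)
    filter_upwards [hev] with z hz
    simpa using hC z hz.1.le hz.2.le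
  · intro z hz
    obtain ⟨t, rfl⟩ : ∃ t : ℝ, z = t := ⟨z.re, Complex.ext rfl (by simpa using hz)⟩
    rw [h.lower]
    exact (φ.le_opNorm _).trans
      (mul_le_mul_of_nonneg_left ((norm_mul_le _ _).trans (hmul t)) (norm_nonneg _))
  · intro z hz
    obtain ⟨t, rfl⟩ : ∃ t : ℝ, z = t + Complex.I :=
      ⟨z.re, Complex.ext (by simp) (by simpa using hz)⟩
    rw [h.upper]
    refine (φ.le_opNorm _).trans
      (mul_le_mul_of_nonneg_left ((norm_mul_le _ _).trans ?_) (norm_nonneg _))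
    rw [mul_comm]
    exact hmul t

theorem IsEigen.isStripFun {x : A} {s : ℝ} (hx : IsEigen φ σ x s) (y : A) :
    IsStripFun φ σ x y fun z => Complex.exp (Complex.I * s * z) * φ (x * y) where
  diff := by fun_prop
  cont := by fun_prop
  bdd := by
    refine ⟨Real.exp |s| * ‖φ (x * y)‖, fun z h0 h1 => ?_⟩
    rw [norm_mul, Complex.norm_exp]
    refine mul_le_mul_of_nonneg_right (Real.exp_le_exp.2 ?_) (norm_nonneg _)
    have : (Complex.I * s * z).re = -s * z.im := by simp
    rw [this]
    calc -s * z.im ≤ |s| * z.im := mul_le_mul_of_nonneg_right (neg_le_abs s) h0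
      _ ≤ |s| * 1 := mul_le_mul_of_nonneg_left h1 (abs_nonneg s)
      _ = |s| := mul_one _
  lower t := by rw [hx.1, smul_mul_assoc, map_smul, smul_eq_mul]
  upper t := by
    rw [hx.1, mul_smul_comm, map_smul, smul_eq_mul, hx.2, ← mul_assoc, ← Complex.exp_add]
    congr 2
    linear_combination (s : ℂ) * Complex.I_mul_I

/-- For `x` in a dense span of eigenvectors the KMS functions are sums of exponentials. By the
Phragmén-Lindelöf principle they depend on `x` continuously with respect to uniform convergence on
the strip, so that they exist for all `x`. -/
theorem exists_isStripFun (hd : Dense (eigenSpan φ σ : Set A)) (x y : A) :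
    ∃ F, IsStripFun φ σ x y F := by
  have hspan : ∀ x ∈ eigenSpan φ σ, ∃ F, IsStripFun φ σ x y F := by
    intro x hx
    induction hx using Submodule.span_induction with
    | mem x hx => obtain ⟨s, hs⟩ := hx; exact ⟨_, hs.isStripFun y⟩
    | zero =>
      exact ⟨fun _ => 0, differentiableOn_const _, continuousOn_const, ⟨0, by simp⟩,
        by simp, by simp⟩
    | add x x' _ _ h h' =>
      obtain ⟨F, hF⟩ := h
      obtain ⟨F', hF'⟩ := h'
      exact ⟨_, hF.add hF'⟩
    | smul c x _ h => obtain ⟨F, hF⟩ := h; exact ⟨_, hF.smul c⟩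
  obtain ⟨u, hu, hux⟩ := mem_closure_iff_seq_limit.1 (hd x)
  choose F hF using fun n => hspan (u n) (hu n)
  set S : Set ℂ := {z | 0 ≤ z.im ∧ z.im ≤ 1} with hS
  have hdiff : ∀ m n, ∀ z ∈ S, ‖F m z - F n z‖ ≤ ‖φ‖ * (‖u m - u n‖ * ‖y‖) :=
    fun m n z hz => ((hF m).sub (hF n)).norm_le hz.1 hz.2
  have hC : UniformCauchySeqOn F Filter.atTop S := by
    rw [Metric.uniformCauchySeqOn_iff]
    intro ε hε
    have hpos : 0 < ‖φ‖ * ‖y‖ + 1 := by positivity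
    obtain ⟨N, hN⟩ := Metric.cauchySeq_iff.1 hux.cauchySeq (ε / (‖φ‖ * ‖y‖ + 1)) (by positivity)
    refine ⟨N, fun m hm n hn z hz => ?_⟩
    have h1 := hN m hm n hn
    rw [dist_eq_norm, lt_div_iff₀ hpos] at h1
    rw [dist_eq_norm]
    refine (hdiff m n z hz).trans_lt (lt_of_le_of_lt ?_ h1)
    nlinarith [norm_nonneg (u m - u n)]
  have hlim : ∀ z, ∃ w, z ∈ S → Filter.Tendsto (fun n => F n z) Filter.atTop (nhds w) := by
    intro z
    by_cases hz : z ∈ S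
    · obtain ⟨w, hw⟩ := cauchySeq_tendsto_of_complete (hC.cauchySeq hz)
      exact ⟨w, fun _ => hw⟩
    · exact ⟨0, fun h => absurd h hz⟩
  choose F₀ hF₀ using hlim
  have hU := hC.tendstoUniformlyOn_of_tendsto hF₀
  have hopen : IsOpen {z : ℂ | 0 < z.im ∧ z.im < 1} :=
    (isOpen_lt continuous_const Complex.continuous_im).inter
      (isOpen_lt Complex.continuous_im continuous_const)
  have hσ : ∀ t, Filter.Tendsto (fun n => σ t (u n)) Filter.atTop (nhds (σ t x)) := fun t => by
    have : Continuous (σ t) := AddMonoidHomClass.continuous_of_bound (σ t) 1 fun a => by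
      rw [one_mul]; exact norm_autom_le t a
    exact (this.tendsto x).comp hux
  refine ⟨F₀, ?_, ?_, ⟨‖φ‖ * (‖x‖ * ‖y‖), fun z h0 h1 => ?_⟩, fun t => ?_, fun t => ?_⟩
  · exact (hU.mono fun z hz => ⟨hz.1.le, hz.2.le⟩).tendstoLocallyUniformlyOn.differentiableOn
      (Filter.Eventually.of_forall fun n => (hF n).diff) hopen
  · exact hU.continuousOn (Filter.Frequently.of_forall fun n => (hF n).cont)
  · exact le_of_tendsto_of_tendsto' (hF₀ z ⟨h0, h1⟩).norm
      ((hux.norm.mul_const ‖y‖).const_mul ‖φ‖) fun n => (hF n).norm_le h0 h1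
  · refine tendsto_nhds_unique (hF₀ t (by simp [hS])) ?_
    simp only [(hF _).lower]
    exact (φ.continuous.tendsto _).comp ((hσ t).mul_const y)
  · refine tendsto_nhds_unique (hF₀ (t + Complex.I) (by simp [hS])) ?_
    simp only [(hF _).upper]
    exact (φ.continuous.tendsto _).comp ((hσ t).const_mul y)

end KMS

/-! ### Weights from positive functionals -/

section OfFunctional

variable {A : Type*} [CStarAlgebra A] [PartialOrder A] [StarOrderedRing A] {φ : A →L[ℂ] ℂ}

theorem map_nonneg_of_star_mul_self (hφ : ∀ a, 0 ≤ φ (star a * a)) {a : A} (ha : 0 ≤ a) :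
    0 ≤ φ a := by
  obtain ⟨b, rfl⟩ := CStarAlgebra.nonneg_iff_eq_star_mul_self.1 ha
  exact hφ b

/-- The everywhere finite weight given by a positive functional. -/
def Weight.ofFunctional (φ : A →L[ℂ] ℂ) (hφ : ∀ a, 0 ≤ φ (star a * a)) : Weight A where
  toFun a := ENNReal.ofReal (φ a).re
  map_add a b ha hb := by
    rw [_root_.map_add, Complex.add_re, ENNReal.ofReal_add]
    · exact (Complex.nonneg_iff.1 (map_nonneg_of_star_mul_self hφ ha)).1
    · exact (Complex.nonneg_iff.1 (map_nonneg_of_star_mul_self hφ hb)).1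
  map_smul c a _ := by
    rw [_root_.map_smul, smul_eq_mul]
    have : ((c : ℂ) * φ a).re = (c : ℝ) * (φ a).re := Complex.re_ofReal_mul (c : ℝ) (φ a)
    rw [this, ENNReal.ofReal_mul c.coe_nonneg, ENNReal.ofReal_coe_nnreal]

variable (hφ : ∀ a, 0 ≤ φ (star a * a))

theorem Weight.mem_finiteSpan (a : A) : a ∈ (Weight.ofFunctional φ hφ).finiteSpan := by
  have h : (Weight.ofFunctional φ hφ).finiteSpan = ⊤ := by
    rw [eq_top_iff, ← CStarAlgebra.span_nonneg]
    exact Submodule.span_mono fun a ha => ⟨ha, ENNReal.ofReal_lt_top⟩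
  rw [h]; trivial

/-- The linear extension of the weight of a positive functional is the functional itself. -/
def Weight.extension : (Weight.ofFunctional φ hφ).finiteSpan →ₗ[ℂ] ℂ :=
  φ.toLinearMap.comp (Submodule.subtype _)

theorem Weight.isLinearExtension : (Weight.ofFunctional φ hφ).IsLinearExtension
    (Weight.extension hφ) := by
  rintro a ⟨ha, _⟩
  have h := Complex.nonneg_iff.1 (map_nonneg_of_star_mul_self hφ ha)
  change φ a = ((ENNReal.ofReal (φ a).re).toReal : ℂ)
  rw [ENNReal.toReal_ofReal h.1]
  exact Complex.ext (by simp) (by simpa using h.2.symm)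

theorem Weight.isProper (h1 : φ 1 ≠ 0) : (Weight.ofFunctional φ hφ).IsProper := by
  refine ⟨⟨1, zero_le_one, ?_⟩, ?_, fun c => ?_⟩
  · have h := Complex.nonneg_iff.1 (map_nonneg_of_star_mul_self hφ (zero_le_one (α := A)))
    change ENNReal.ofReal (φ 1).re ≠ 0
    rw [Ne, ENNReal.ofReal_eq_zero, not_le]
    refine lt_of_le_of_ne h.1 fun h0 => h1 (Complex.ext h0.symm h.2.symm)
  · exact fun a => subset_closure (Weight.mem_finiteSpan hφ a)
  · exact CStarAlgebra.isClosed_nonneg.inter (isClosed_le (ENNReal.continuous_ofReal.comp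
      (Complex.continuous_re.comp φ.continuous)) continuous_const)

theorem Weight.isKMS {σ : ℝ → (A ≃⋆ₐ[ℂ] A)} (h1 : φ 1 ≠ 0) (hσ : ∀ t a, φ (σ t a) = φ a)
    (hd : Dense (eigenSpan φ σ : Set A)) :
    (Weight.ofFunctional φ hφ).IsKMS (Weight.extension hφ) σ := by
  refine ⟨Weight.isProper hφ h1, fun t a _ => ?_, fun x y _ _ _ _ => ?_⟩
  · change ENNReal.ofReal (φ (σ t a)).re = ENNReal.ofReal (φ a).re
    rw [hσ]
  · obtain ⟨F, hF⟩ := exists_isStripFun hd x y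
    exact ⟨F, hF.diff, hF.cont, hF.bdd, fun t => ⟨⟨Weight.mem_finiteSpan hφ _, hF.lower t⟩,
      ⟨Weight.mem_finiteSpan hφ _, hF.upper t⟩⟩⟩

end OfFunctional

/-! ### The torus action and the time evolution -/

namespace GraphCStar

variable {V E : Type*} [Fintype V] [Fintype E] (G : DirGraph V E)

theorem rotateFamily_rotateFamily (u u' : E → Circle) (i : G.CKFamily Op) :
    rotateFamily G u' (rotateFamily G u i) = rotateFamily G (u' * u) i := by
  unfold rotateFamily
  congr 1
  funext e
  rw [smul_smul, Pi.mul_apply, Circle.coe_mul]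

theorem rotateFamily_one (i : G.CKFamily Op) : rotateFamily G 1 i = i := by
  obtain ⟨P, S, _, _, _, _, _⟩ := i
  unfold rotateFamily
  congr 1
  funext e
  rw [Pi.one_apply, Circle.coe_one, one_smul]

theorem rotate_rotate (u u' : E → Circle) (a : GraphCStar G) :
    rotate G u (rotate G u' a) = rotate G (u' * u) a :=
  ext_family G fun i => congrArg (fun j => a.1 j) (rotateFamily_rotateFamily G u u' i)

theorem rotate_one (a : GraphCStar G) : rotate G 1 a = a :=
  ext_family G fun i => congrArg (fun j => a.1 j) (rotateFamily_one G i)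

theorem rotate_Spath (u : E → Circle) (μ : G.Path) :
    rotate G u (Spath G μ) = ((μ.edges.map u).prod : ℂ) • Spath G μ := by
  have h : ∀ l : List E, rotate G u (l.map (S G)).prod =
      ((l.map u).prod : ℂ) • (l.map (S G)).prod := by
    intro l
    induction l with
    | nil => simp
    | cons e l ih =>
      rw [List.map_cons, List.prod_cons, map_mul, ih, rotate_S, smul_mul_smul_comm, List.map_cons,
        List.prod_cons, Circle.coe_mul]
  rw [Spath, map_mul, h, rotate_P, mul_smul_comm]

theorem rotate_mul_star (u : E → Circle) (μ ν : G.Path) :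
    rotate G u (Spath G μ * star (Spath G ν)) =
      (((μ.edges.map u).prod * ((ν.edges.map u).prod)⁻¹ : Circle) : ℂ) •
        (Spath G μ * star (Spath G ν)) := by
  rw [map_mul, map_star, rotate_Spath, rotate_Spath, star_smul, smul_mul_smul_comm,
    Circle.coe_mul, Circle.coe_inv_eq_conj]
  rfl

end GraphCStar

namespace CTensor

variable {A B : Type*} [CStarAlgebra A] [CStarAlgebra B]

theorem map_map (α α' : A →⋆ₐ[ℂ] A) (β β' : B →⋆ₐ[ℂ] B) (x : CTensor A B) :
    map α β (map α' β' x) = map (α.comp α') (β.comp β') x :=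
  Subtype.ext <| Subtype.ext <| funext fun _ => rfl

theorem map_id (x : CTensor A B) : map (StarAlgHom.id ℂ A) (StarAlgHom.id ℂ B) x = x :=
  Subtype.ext <| Subtype.ext <| funext fun _ => rfl

end CTensor

namespace OrientedCW

variable {V E F : Type*} [Fintype V] [Fintype E] [Fintype F] (B : OrientedCW V E F)

/-- The endomorphism with `S_e ↦ u e • S_e` and `S_c ↦ w c • S_c` that fixes all projections. -/
def torus (u : E → Circle) (w : B.Corner → Circle) : B.CStar →⋆ₐ[ℂ] B.CStar :=
  CTensor.map (GraphCStar.rotate _ u) (GraphCStar.rotate _ w)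

theorem torus_torus (u u' : E → Circle) (w w' : B.Corner → Circle) (a : B.CStar) :
    B.torus u w (B.torus u' w' a) = B.torus (u' * u) (w' * w) a := by
  rw [torus, torus, CTensor.map_map, torus]
  congr 2
  · exact StarAlgHom.ext fun a => GraphCStar.rotate_rotate _ u u' a
  · exact StarAlgHom.ext fun a => GraphCStar.rotate_rotate _ w w' a

theorem torus_one (a : B.CStar) : B.torus 1 1 a = a := by
  have h1 : GraphCStar.rotate B.skeleton 1 = StarAlgHom.id ℂ (GraphCStar B.skeleton) :=
    StarAlgHom.ext fun a => GraphCStar.rotate_one _ a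
  have h2 : GraphCStar.rotate B.boundary 1 = StarAlgHom.id ℂ (GraphCStar B.boundary) :=
    StarAlgHom.ext fun a => GraphCStar.rotate_one _ a
  exact (congrArg₂ (fun α β => CTensor.map α β a) h1 h2).trans (CTensor.map_id a)

theorem torus_inl (u : E → Circle) (w : B.Corner → Circle) (a : GraphCStar B.skeleton) :
    B.torus u w (CTensor.inl a) = CTensor.inl (GraphCStar.rotate _ u a) := rfl

theorem torus_inr (u : E → Circle) (w : B.Corner → Circle) (b : GraphCStar B.boundary) :
    B.torus u w (CTensor.inr b) = CTensor.inr (GraphCStar.rotate _ w b) := rfl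

theorem torus_monomial (u : E → Circle) (w : B.Corner → Circle) (μ ν : B.skeleton.Path)
    (Ω Λ : B.boundary.Path) : B.torus u w (B.monomial μ ν Ω Λ) =
      (((μ.edges.map u).prod * ((ν.edges.map u).prod)⁻¹ *
        ((Ω.edges.map w).prod * ((Λ.edges.map w).prod)⁻¹) : Circle) : ℂ) •
          B.monomial μ ν Ω Λ := by
  have h1 := (B.torus_inl u w _).trans
    (congrArg CTensor.inl (GraphCStar.rotate_mul_star B.skeleton u μ ν))
  have h2 := (B.torus_inr u w _).trans
    (congrArg CTensor.inr (GraphCStar.rotate_mul_star B.boundary w Ω Λ))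
  rw [map_smul] at h1 h2
  rw [monomial_eq, map_mul, h1, h2, smul_mul_smul_comm, ← Circle.coe_mul]

theorem torus_mem (u : E → Circle) (w : B.Corner → Circle) {x : B.CStar} (hx : x ∈ B.MB) :
    B.torus u w x ∈ B.MB := by
  induction hx using Submodule.span_induction with
  | mem x hx =>
    obtain ⟨μ, ν, Ω, Λ, h, h', rfl⟩ := hx
    rw [torus_monomial]
    exact B.MB.smul_mem _ (B.monomial_mem h h')
  | zero => rw [map_zero]; exact B.MB.zero_mem
  | add x y _ _ hx hy => rw [map_add]; exact B.MB.add_mem hx hy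
  | smul c x _ hx => rw [map_smul]; exact B.MB.smul_mem c hx

theorem continuous_torus (u : E → Circle) (w : B.Corner → Circle) : Continuous (B.torus u w) :=
  AddMonoidHomClass.continuous_of_bound (B.torus u w) 1 fun a => by
    rw [one_mul]; exact NonUnitalStarAlgHom.norm_apply_le (B.torus u w) a

/-- The automorphism with `S_e ↦ a(e)^{it} S_e` and `S_c ↦ b(c)^{it} S_c`, for positive `a`
and `b`. -/
def evolution (a : E → ℝ) (b : B.Corner → ℝ) (t : ℝ) : B.CStar ≃⋆ₐ[ℂ] B.CStar :=
  StarAlgEquiv.ofStarAlgHom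
    (B.torus (fun e => Circle.exp (Real.log (a e) * t)) fun c => Circle.exp (Real.log (b c) * t))
    (B.torus (fun e => Circle.exp (Real.log (a e) * -t)) fun c => Circle.exp (Real.log (b c) * -t))
    (by
      refine StarAlgHom.ext fun x => ?_
      refine (B.torus_torus _ _ _ _ x).trans ?_
      refine Eq.trans ?_ (B.torus_one x)
      congr 2 <;> funext e <;> simp [Pi.mul_apply])
    (by
      refine StarAlgHom.ext fun x => ?_
      refine (B.torus_torus _ _ _ _ x).trans ?_
      refine Eq.trans ?_ (B.torus_one x)
      congr 2 <;> funext e <;> simp [Pi.mul_apply])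

variable (a : E → ℝ) (b : B.Corner → ℝ)

theorem evolution_apply (t : ℝ) (x : B.CStar) : B.evolution a b t x =
    B.torus (fun e => Circle.exp (Real.log (a e) * t))
      (fun c => Circle.exp (Real.log (b c) * t)) x := rfl

theorem evolution_zero (x : B.CStar) : B.evolution a b 0 x = x := by
  rw [evolution_apply]
  refine Eq.trans ?_ (B.torus_one x)
  congr 2 <;> funext e <;> simp

theorem evolution_add (t t' : ℝ) (x : B.CStar) :
    B.evolution a b (t + t') x = B.evolution a b t (B.evolution a b t' x) := by
  rw [evolution_apply, evolution_apply, evolution_apply, torus_torus]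
  congr 2 <;> funext e <;> rw [Pi.mul_apply, ← Circle.exp_add] <;> congr 1 <;> ring

theorem evolution_Pv (t : ℝ) (v : V) : B.evolution a b t (B.Pv v) = B.Pv v := rfl

theorem evolution_Pe (t : ℝ) (e : E) : B.evolution a b t (B.Pe e) = B.Pe e := rfl

theorem evolution_Se (t : ℝ) (e : E) : B.evolution a b t (B.Se e) =
    Complex.exp (Complex.I * (Real.log (a e) : ℝ) * t) • B.Se e := by
  refine Eq.trans (congrArg CTensor.inl (GraphCStar.rotate_S _ _ e)) ?_
  rw [map_smul, Circle.coe_exp]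
  congr 2
  push_cast; ring

theorem evolution_Sc (t : ℝ) (c : B.Corner) : B.evolution a b t (B.Sc c) =
    Complex.exp (Complex.I * (Real.log (b c) : ℝ) * t) • B.Sc c := by
  refine Eq.trans (congrArg CTensor.inr (GraphCStar.rotate_S _ _ c)) ?_
  rw [map_smul, Circle.coe_exp]
  congr 2
  push_cast; ring

/-! ### The functional of a rank 2 graph weight -/

open Classical in
/-- The continuous functional `φ` has the values prescribed by the product formula. -/
def HasProductValues (g : V → ℝ) (lamT lam : E → ℝ) (η : F → ℝ) (φ : B.CStar →L[ℂ] ℂ) : Prop :=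
  ∀ (μ ν : B.skeleton.Path) (Ω Λ : B.boundary.Path), μ.tgt = ν.tgt → Ω.tgt = Λ.tgt →
    φ (B.monomial μ ν Ω Λ) = if μ = ν ∧ Ω = Λ then
      (((μ.edges.map lamT).prod * g μ.tgt *
          ((Ω.edges.map fun c => η c.1).prod * lam Ω.tgt) : ℝ) : ℂ) else 0

variable {B}

namespace HasProductValues

variable {g : V → ℝ} {lamT lam : E → ℝ} {η : F → ℝ} {φ : B.CStar →L[ℂ] ℂ}
  (hφ : B.HasProductValues g lamT lam η φ)

include hφ

/-- The functional `φ` is invariant under all phases: they cancel on `S_μ S_μ* S_Ω S_Ω*`. -/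
theorem map_torus (u : E → Circle) (w : B.Corner → Circle) (x : B.CStar) :
    φ (B.torus u w x) = φ x := by
  refine congrFun (Continuous.ext_on B.dense_MB (φ.continuous.comp (B.continuous_torus u w))
    φ.continuous fun x hx => ?_) x
  change φ (B.torus u w x) = φ x
  induction hx using Submodule.span_induction with
  | mem x hx =>
    obtain ⟨μ, ν, Ω, Λ, h, h', rfl⟩ := hx
    rw [torus_monomial, map_smul, hφ _ _ _ _ h h']
    split_ifs with heq
    · obtain ⟨rfl, rfl⟩ := heq
      simp
    · exact smul_zero _
  | zero => simp
  | add x y _ _ hx hy => rw [map_add, map_add, map_add, hx, hy]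
  | smul c x _ hx => rw [map_smul, map_smul, map_smul, hx]

open Classical in
/-- For a fixed second tensor factor, `φ` has values of the form `HasPathValues` on the graph
C*-algebra of the 1-skeleton. -/
theorem skeleton {Ω Λ : B.boundary.Path} (h' : Ω.tgt = Λ.tgt) :
    GraphCStar.HasPathValues B.skeleton g lamT
      (if Ω = Λ then (((Ω.edges.map fun c => η c.1).prod * lam Ω.tgt : ℝ) : ℂ) else 0)
      ((φ.toLinearMap.comp (LinearMap.mulRight ℂ (CTensor.inr (GraphCStar.Spath _ Ω *
        star (GraphCStar.Spath _ Λ)) : B.CStar))).comp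
          (CTensor.inl : _ →⋆ₐ[ℂ] B.CStar).toAlgHom.toLinearMap) := by
  intro μ ν h
  have := hφ μ ν Ω Λ h h'
  rw [monomial_eq] at this
  refine Eq.trans this ?_
  by_cases h1 : μ = ν <;> by_cases h2 : Ω = Λ <;> simp [h1, h2]

open Classical in
/-- For a fixed first tensor factor, `φ` has values of the form `HasPathValues` on the graph
C*-algebra of the boundary graph. -/
theorem boundary {μ ν : B.skeleton.Path} (h : μ.tgt = ν.tgt) :
    GraphCStar.HasPathValues B.boundary lam (fun c => η c.1)
      (if μ = ν then (((μ.edges.map lamT).prod * g μ.tgt : ℝ) : ℂ) else 0)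
      ((φ.toLinearMap.comp (LinearMap.mulLeft ℂ (CTensor.inl (GraphCStar.Spath _ μ *
        star (GraphCStar.Spath _ ν)) : B.CStar))).comp
          (CTensor.inr : _ →⋆ₐ[ℂ] B.CStar).toAlgHom.toLinearMap) := by
  intro Ω Λ h'
  have := hφ μ ν Ω Λ h h'
  rw [monomial_eq] at this
  refine Eq.trans this ?_
  by_cases h1 : μ = ν <;> by_cases h2 : Ω = Λ <;> simp [h1, h2, mul_comm]

omit hφ in
theorem comm_of_monomial (x : B.CStar) (c : ℂ)
    (h : ∀ (μ ν : B.skeleton.Path) (Ω Λ : B.boundary.Path), μ.tgt = ν.tgt → Ω.tgt = Λ.tgt →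
      φ (x * B.monomial μ ν Ω Λ) = c * φ (B.monomial μ ν Ω Λ * x)) (y : B.CStar) :
    φ (x * y) = c * φ (y * x) := by
  refine congrFun (Continuous.ext_on B.dense_MB
    (f := fun y => φ (x * y)) (g := fun y => c * φ (y * x))
    (φ.continuous.comp (continuous_const.mul continuous_id))
    (continuous_const.mul (φ.continuous.comp (continuous_id.mul continuous_const)))
    fun y hy => ?_) y
  change φ (x * y) = c * φ (y * x)
  induction hy using Submodule.span_induction with
  | mem y hy => obtain ⟨μ, ν, Ω, Λ, h1, h2, rfl⟩ := hy; exact h μ ν Ω Λ h1 h2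
  | zero => simp
  | add y z _ _ hy hz => rw [mul_add, add_mul, map_add, map_add, hy, hz, mul_add]
  | smul d y _ hy =>
    rw [mul_smul_comm, smul_mul_assoc, map_smul, map_smul, hy, smul_eq_mul, smul_eq_mul]
    ring

theorem inl_comm {s : GraphCStar B.skeleton} {r : ℂ}
    (hs : ∀ (C : ℂ) (χ : GraphCStar B.skeleton →ₗ[ℂ] ℂ),
      GraphCStar.HasPathValues B.skeleton g lamT C χ → ∀ μ ν : B.skeleton.Path, μ.tgt = ν.tgt →
        χ (s * (GraphCStar.Spath _ μ * star (GraphCStar.Spath _ ν))) =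
          r * χ (GraphCStar.Spath _ μ * star (GraphCStar.Spath _ ν) * s)) (y : B.CStar) :
    φ (CTensor.inl s * y) = r * φ (y * CTensor.inl s) := by
  refine comm_of_monomial _ r (fun μ ν Ω Λ h h' => ?_) y
  have h1 := hs _ _ (hφ.skeleton h') μ ν h
  have e1 (m : GraphCStar B.skeleton) (n : GraphCStar B.boundary) :
      (CTensor.inl s * (CTensor.inl m * CTensor.inr n) : B.CStar) =
        CTensor.inl (s * m) * CTensor.inr n := by rw [map_mul, mul_assoc]
  have e2 (m : GraphCStar B.skeleton) (n : GraphCStar B.boundary) :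
      (CTensor.inl m * CTensor.inr n * CTensor.inl s : B.CStar) =
        CTensor.inl (m * s) * CTensor.inr n := by
    rw [map_mul, mul_assoc, ← CTensor.inl_mul_inr, mul_assoc]
  rw [monomial_eq, e1, e2]
  exact h1

theorem inr_comm {s : GraphCStar B.boundary} {r : ℂ}
    (hs : ∀ (C : ℂ) (χ : GraphCStar B.boundary →ₗ[ℂ] ℂ),
      GraphCStar.HasPathValues B.boundary lam (fun c => η c.1) C χ →
        ∀ Ω Λ : B.boundary.Path, Ω.tgt = Λ.tgt →
        χ (s * (GraphCStar.Spath _ Ω * star (GraphCStar.Spath _ Λ))) =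
          r * χ (GraphCStar.Spath _ Ω * star (GraphCStar.Spath _ Λ) * s)) (y : B.CStar) :
    φ (CTensor.inr s * y) = r * φ (y * CTensor.inr s) := by
  refine comm_of_monomial _ r (fun μ ν Ω Λ h h' => ?_) y
  have h1 := hs _ _ (hφ.boundary h) Ω Λ h'
  have e1 (m : GraphCStar B.skeleton) (n : GraphCStar B.boundary) :
      (CTensor.inr s * (CTensor.inl m * CTensor.inr n) : B.CStar) =
        CTensor.inl m * CTensor.inr (s * n) := by
    rw [map_mul, ← mul_assoc, ← CTensor.inl_mul_inr, mul_assoc]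
  have e2 (m : GraphCStar B.skeleton) (n : GraphCStar B.boundary) :
      (CTensor.inl m * CTensor.inr n * CTensor.inr s : B.CStar) =
        CTensor.inl m * CTensor.inr (n * s) := by rw [map_mul, mul_assoc]
  rw [monomial_eq, e1, e2]
  exact h1

variable (hT : ∀ e, 0 < lamT e) (hη : ∀ f, 0 < η f)

theorem isEigen_Pv (v : V) :
    IsEigen φ (B.evolution lamT fun c => η c.1) (B.Pv v) 0 := by
  refine ⟨fun t => by rw [evolution_Pv]; simp, fun y => ?_⟩
  rw [Complex.ofReal_zero, Complex.exp_zero]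
  exact hφ.inl_comm (fun C χ hχ μ ν h => by rw [one_mul]; exact hχ.P_mul _ v h) y

theorem isEigen_Pe (e : E) :
    IsEigen φ (B.evolution lamT fun c => η c.1) (B.Pe e) 0 := by
  refine ⟨fun t => by rw [evolution_Pe]; simp, fun y => ?_⟩
  rw [Complex.ofReal_zero, Complex.exp_zero]
  exact hφ.inr_comm (fun C χ hχ μ ν h => by rw [one_mul]; exact hχ.P_mul _ e h) y

include hT in
theorem isEigen_Se (e : E) :
    IsEigen φ (B.evolution lamT fun c => η c.1) (B.Se e) (Real.log (lamT e)) := by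
  refine ⟨fun t => B.evolution_Se _ _ t e, fun y => ?_⟩
  rw [← Complex.ofReal_exp, Real.exp_log (hT e)]
  exact hφ.inl_comm (fun C χ hχ μ ν h => hχ.S_mul _ e h) y

include hη in
theorem isEigen_Sc (c : B.Corner) :
    IsEigen φ (B.evolution lamT fun c => η c.1) (B.Sc c) (Real.log (η c.1)) := by
  refine ⟨fun t => B.evolution_Sc _ _ t c, fun y => ?_⟩
  rw [← Complex.ofReal_exp, Real.exp_log (hη c.1)]
  exact hφ.inr_comm (fun C χ hχ μ ν h => hχ.S_mul _ c h) y

include hT in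
theorem exists_isEigen_inl (μ : B.skeleton.Path) : ∃ s, IsEigen φ
    (B.evolution lamT fun c => η c.1) (CTensor.inl (GraphCStar.Spath _ μ)) s := by
  have h : ∀ l : List E, ∃ s, IsEigen φ (B.evolution lamT fun c => η c.1)
      (B.Pv μ.src * CTensor.inl (l.map (GraphCStar.S _)).prod) s := by
    intro l
    induction l using List.reverseRecOn with
    | nil => exact ⟨0, by simpa using hφ.isEigen_Pv μ.src⟩
    | append_singleton l e ih =>
      obtain ⟨s, hs⟩ := ih
      refine ⟨s + Real.log (lamT e), ?_⟩
      rw [List.map_append, List.prod_append, map_mul, ← mul_assoc, List.map_singleton,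
        List.prod_singleton]
      exact hs.mul (hφ.isEigen_Se hT e)
  obtain ⟨s, hs⟩ := h μ.edges
  exact ⟨s, by rw [GraphCStar.Spath, map_mul]; exact hs⟩

include hη in
theorem exists_isEigen_inr (Ω : B.boundary.Path) : ∃ s, IsEigen φ
    (B.evolution lamT fun c => η c.1) (CTensor.inr (GraphCStar.Spath _ Ω)) s := by
  have h : ∀ l : List B.Corner, ∃ s, IsEigen φ (B.evolution lamT fun c => η c.1)
      (B.Pe Ω.src * CTensor.inr (l.map (GraphCStar.S _)).prod) s := by
    intro l
    induction l using List.reverseRecOn with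
    | nil => exact ⟨0, by simpa using hφ.isEigen_Pe Ω.src⟩
    | append_singleton l e ih =>
      obtain ⟨s, hs⟩ := ih
      refine ⟨s + Real.log (η e.1), ?_⟩
      rw [List.map_append, List.prod_append, map_mul, ← mul_assoc, List.map_singleton,
        List.prod_singleton]
      exact hs.mul (hφ.isEigen_Sc hη e)
  obtain ⟨s, hs⟩ := h Ω.edges
  exact ⟨s, by rw [GraphCStar.Spath, map_mul]; exact hs⟩

include hT hη in
theorem dense_eigenSpan (hpos : ∀ a, 0 ≤ φ (star a * a)) :
    Dense (eigenSpan φ (B.evolution lamT fun c => η c.1) : Set B.CStar) := by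
  refine B.dense_MB.mono (Submodule.span_mono ?_)
  rintro _ ⟨μ, ν, Ω, Λ, -, -, rfl⟩
  obtain ⟨s₁, h₁⟩ := hφ.exists_isEigen_inl hT μ
  obtain ⟨s₂, h₂⟩ := hφ.exists_isEigen_inl hT ν
  obtain ⟨s₃, h₃⟩ := hφ.exists_isEigen_inr hη Ω
  obtain ⟨s₄, h₄⟩ := hφ.exists_isEigen_inr hη Λ
  exact ⟨_, ((h₁.mul (h₂.star hpos)).mul h₃).mul (h₄.star hpos)⟩

theorem map_one_eq : φ 1 = (((∑ v, g v) * ∑ e, lam e : ℝ) : ℂ) := by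
  have h1 : (1 : B.CStar) = ∑ v, ∑ e, B.monomial (.nil _ v) (.nil _ v) (.nil _ e) (.nil _ e) := by
    simp only [monomial_eq, GraphCStar.Spath_nil, GraphCStar.star_P, GraphCStar.P_mul_P_self]
    simp only [← Finset.mul_sum, ← Finset.sum_mul]
    rw [← map_sum, ← map_sum, GraphCStar.sum_proj, GraphCStar.sum_proj, map_one, map_one, one_mul]
  rw [h1, map_sum, Finset.sum_mul_sum]
  push_cast
  refine Finset.sum_congr rfl fun v _ => ?_
  rw [map_sum]
  refine Finset.sum_congr rfl fun e _ => ?_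
  rw [hφ _ _ _ _ rfl rfl, if_pos ⟨rfl, rfl⟩]
  simp [DirGraph.Path.nil]

end HasProductValues

/-- A rank 2 graph weight defines a positive functional on `C*(B)`. -/
theorem exists_hasProductValues [Nonempty E] {g : V → ℝ} {lamT lam : E → ℝ} {η : F → ℝ}
    (hw : B.IsRankTwoGraphWeight g lamT lam η) :
    ∃ φ : B.CStar →L[ℂ] ℂ, (∀ a, 0 ≤ φ (star a * a)) ∧ B.HasProductValues g lamT lam η φ := by
  have : Nonempty V := ⟨B.skeleton.s (Classical.arbitrary E)⟩
  obtain ⟨φ, hpos, hφ⟩ := exists_productState hw.1 hw.2.1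
  exact ⟨φ, hpos, fun μ ν Ω Λ h h' => by rw [monomial_eq]; exact hφ μ ν Ω Λ h h'⟩

theorem eq_of_isProductFormula {g : V → ℝ} {lamT lam : E → ℝ} {η : F → ℝ} {ψ ψ' : B.MB →ₗ[ℂ] ℂ}
    (h : B.IsProductFormula g lamT lam η ψ) (h' : B.IsProductFormula g lamT lam η ψ') :
    ψ' = ψ := by
  refine LinearMap.ext fun x => ?_
  obtain ⟨x, hx⟩ := x
  induction hx using Submodule.span_induction with
  | mem x hx =>
    obtain ⟨μ, ν, Ω, Λ, h1, h2, rfl⟩ := hx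
    exact (h' μ ν Ω Λ h1 h2).trans (h μ ν Ω Λ h1 h2).symm
  | zero => exact (map_zero ψ').trans (map_zero ψ).symm
  | add x y hx hy ihx ihy =>
    exact (map_add ψ' ⟨x, hx⟩ ⟨y, hy⟩).trans
      ((congrArg₂ (· + ·) ihx ihy).trans (map_add ψ ⟨x, hx⟩ ⟨y, hy⟩).symm)
  | smul c x hx ih =>
    exact (map_smul ψ' c ⟨x, hx⟩).trans
      ((congrArg (c • ·) ih).trans (map_smul ψ c ⟨x, hx⟩).symm)

end OrientedCW

namespace OrientedCW

variable {V E F : Type*} [Fintype V] [Fintype E] [Fintype F] {B : OrientedCW V E F}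

/-! ### The rank 2 graph weight of a faithful weight -/

theorem inl_P_ne_zero [Nonempty E] (v : V) : B.Pv v ≠ 0 := fun h =>
  inl_P_mul_inr_P_ne_zero (G := B.skeleton) (G' := B.boundary) v (Classical.arbitrary E) <| by
    change B.Pv v * _ = 0
    rw [h, zero_mul]

theorem inr_P_ne_zero (e : E) : B.Pe e ≠ 0 := fun h =>
  inl_P_mul_inr_P_ne_zero (G := B.skeleton) (G' := B.boundary) (B.skeleton.s e) e <| by
    change _ * B.Pe e = 0
    rw [h, mul_zero]

theorem star_Se_mem (e : E) : star (B.Se e) ∈ B.MB := by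
  have h := B.inl_mem (μ := .nil _ (B.skeleton.r e)) (ν := .single _ e) rfl
  rwa [GraphCStar.Spath_nil, GraphCStar.Spath_single, GraphCStar.P_mul_star_S, map_star] at h

theorem star_Sc_mem (c : B.Corner) : star (B.Sc c) ∈ B.MB := by
  have h := B.inr_mem (Ω := .nil _ (B.boundary.r c)) (Λ := .single _ c) rfl
  rwa [GraphCStar.Spath_nil, GraphCStar.Spath_single, GraphCStar.P_mul_star_S, map_star] at h

theorem mStarSe_eq (e : E) : B.mStarSe e = B.mPv (B.skeleton.r e) := by
  refine Subtype.ext ?_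
  change star (B.Se e) * B.Se e = B.Pv _
  rw [Se, Pv, ← GraphCStar.star_mul, map_mul, map_star]

theorem mStarSc_eq (c : B.Corner) : B.mStarSc c = B.mPe (B.boundary.r c) := by
  refine Subtype.ext ?_
  change star (B.Sc c) * B.Sc c = B.Pe _
  rw [Sc, Pe, ← GraphCStar.star_mul, map_mul, map_star]

open Classical in
theorem mPv_eq_sum {v : V} (hv : ¬ B.skeleton.IsSink v) :
    B.mPv v = ∑ e with B.skeleton.s e = v, B.mSeStar e := by
  refine Subtype.ext ?_
  rw [AddSubmonoidClass.coe_finsetSum]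
  change B.Pv v = ∑ e with B.skeleton.s e = v, B.Se e * star (B.Se e)
  rw [Pv, GraphCStar.ck _ v hv, map_sum]
  refine Finset.sum_congr rfl fun e _ => ?_
  rw [Se, map_mul, map_star]

open Classical in
theorem mPe_eq_sum {e : E} (he : ¬ B.boundary.IsSink e) :
    B.mPe e = ∑ c with B.boundary.s c = e, B.mScStar c := by
  refine Subtype.ext ?_
  rw [AddSubmonoidClass.coe_finsetSum]
  change B.Pe e = ∑ c with B.boundary.s c = e, B.Sc c * star (B.Sc c)
  rw [Pe, GraphCStar.ck _ e he, map_sum]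
  refine Finset.sum_congr rfl fun e _ => ?_
  rw [Sc, map_mul, map_star]

variable {ψ : B.MB →ₗ[ℂ] ℂ}

theorem IsWeight.exists_pos (hψ : B.IsWeight ψ) (hf : B.IsFaithful ψ) {x y : B.MB}
    (h : (y : B.CStar) = star (x : B.CStar) * x) (hx : (x : B.CStar) ≠ 0) :
    ∃ r : ℝ, 0 < r ∧ (r : ℂ) = ψ y := by
  have h0 := Complex.nonneg_iff.1 (hψ x y h)
  have he : (((ψ y).re : ℝ) : ℂ) = ψ y := Complex.ext rfl h0.2
  refine ⟨(ψ y).re, lt_of_le_of_ne h0.1 fun h1 => hx ?_, he⟩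
  rw [← h1, Complex.ofReal_zero] at he
  rw [hf x y h he.symm]
  rfl

/-- Positivity of all the values follows from faithfulness; the equations of a rank 2 graph weight are
`ψ` applied to the Cuntz-Krieger relations. -/
theorem IsWeight.exists_rankTwo [Nonempty E] (hψ : B.IsWeight ψ) (hf : B.IsFaithful ψ)
    (hη : ∀ c c' : B.Corner, c.1 = c'.1 →
      ψ (B.mScStar c) / ψ (B.mStarSc c) = ψ (B.mScStar c') / ψ (B.mStarSc c')) :
    ∃ (g : V → ℝ) (lamT lam : E → ℝ) (η : F → ℝ),
      (∀ v, (g v : ℂ) = ψ (B.mPv v)) ∧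
      (∀ e, (lamT e : ℂ) = ψ (B.mSeStar e) / ψ (B.mStarSe e)) ∧
      (∀ e, (lam e : ℂ) = ψ (B.mPe e)) ∧
      (∀ c : B.Corner, (η c.1 : ℂ) = ψ (B.mScStar c) / ψ (B.mStarSc c)) ∧
      B.IsRankTwoGraphWeight g lamT lam η ∧ IsFaithfulData g lamT lam η := by
  classical
  have hP : ∀ v, ∃ r : ℝ, 0 < r ∧ (r : ℂ) = ψ (B.mPv v) := fun v => by
    refine hψ.exists_pos hf (x := B.mPv v) ?_ (inl_P_ne_zero v)
    change B.Pv v = star (B.Pv v) * B.Pv v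
    rw [Pv, ← map_star, ← map_mul, GraphCStar.star_P, GraphCStar.P_mul_P_self]
  have hPe : ∀ e, ∃ r : ℝ, 0 < r ∧ (r : ℂ) = ψ (B.mPe e) := fun e => by
    refine hψ.exists_pos hf (x := B.mPe e) ?_ (inr_P_ne_zero e)
    change B.Pe e = star (B.Pe e) * B.Pe e
    rw [Pe, ← map_star, ← map_mul, GraphCStar.star_P, GraphCStar.P_mul_P_self]
  have hS : ∀ e, ∃ r : ℝ, 0 < r ∧ (r : ℂ) = ψ (B.mSeStar e) := fun e => by
    refine hψ.exists_pos hf (x := ⟨star (B.Se e), star_Se_mem e⟩) ?_ fun h => ?_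
    · change B.Se e * star (B.Se e) = star (star (B.Se e)) * star (B.Se e)
      rw [star_star]
    · refine inl_P_ne_zero (B := B) (B.skeleton.r e) ?_
      have h' : star (B.Se e) = 0 := h
      have := congrArg Subtype.val (mStarSe_eq (B := B) e)
      refine this.symm.trans ?_
      change star (B.Se e) * B.Se e = 0
      rw [h', zero_mul]
  have hSc : ∀ c, ∃ r : ℝ, 0 < r ∧ (r : ℂ) = ψ (B.mScStar c) := fun c => by
    refine hψ.exists_pos hf (x := ⟨star (B.Sc c), star_Sc_mem c⟩) ?_ fun h => ?_
    · change B.Sc c * star (B.Sc c) = star (star (B.Sc c)) * star (B.Sc c)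
      rw [star_star]
    · refine inr_P_ne_zero (B := B) (B.boundary.r c) ?_
      have h' : star (B.Sc c) = 0 := h
      have := congrArg Subtype.val (mStarSc_eq (B := B) c)
      refine this.symm.trans ?_
      change star (B.Sc c) * B.Sc c = 0
      rw [h', zero_mul]
  choose g hg hg' using hP
  choose lam hlam hlam' using hPe
  choose p hp hp' using hS
  choose q hq hq' using hSc
  -- A face with empty boundary has no corner; it gets the value `1`.
  have hη' : ∀ f, ∃ r : ℝ, 0 < r ∧ ∀ c : B.Corner, c.1 = f → r = q c / lam (B.boundary.r c) := by
    intro f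
    by_cases h : ∃ c : B.Corner, c.1 = f
    · obtain ⟨c, rfl⟩ := h
      refine ⟨q c / lam (B.boundary.r c), div_pos (hq c) (hlam _), fun c' hc' => ?_⟩
      have := hη c c' hc'.symm
      rw [mStarSc_eq, mStarSc_eq, ← hq', ← hq', ← hlam', ← hlam'] at this
      exact_mod_cast this
    · exact ⟨1, one_pos, fun c hc => absurd ⟨c, hc⟩ h⟩
  choose η hη0 hη1 using hη'
  have hT0 : ∀ e, 0 < p e / g (B.skeleton.r e) := fun e => div_pos (hp e) (hg _)
  refine ⟨g, fun e => p e / g (B.skeleton.r e), lam, η, hg', fun e => ?_, hlam', fun c => ?_,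
    ⟨⟨fun v => (hg v).le, fun e => (hT0 e).le, fun v hv => ?_⟩,
      ⟨fun e => (hlam e).le, fun c => (hη0 c.1).le, fun e he => ?_⟩, fun f => (hη0 f).le⟩,
    fun v => (hg v).ne', fun e => (hT0 e).ne', fun e => (hlam e).ne', fun f => (hη0 f).ne'⟩
  · rw [mStarSe_eq, ← hp', ← hg', Complex.ofReal_div]
  · rw [hη1 c.1 c rfl, mStarSc_eq, ← hq', ← hlam', Complex.ofReal_div]
  · have h1 : (g v : ℂ) = ((∑ e with B.skeleton.s e = v, p e : ℝ) : ℂ) := by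
      rw [hg', mPv_eq_sum hv, map_sum, Complex.ofReal_sum]
      exact Finset.sum_congr rfl fun e _ => (hp' e).symm
    rw [Complex.ofReal_inj.1 h1]
    exact Finset.sum_congr rfl fun e _ => (div_mul_cancel₀ _ (hg _).ne').symm
  · have h1 : (lam e : ℂ) = ((∑ c with B.boundary.s c = e, q c : ℝ) : ℂ) := by
      rw [hlam', mPe_eq_sum he, map_sum, Complex.ofReal_sum]
      exact Finset.sum_congr rfl fun c _ => (hq' c).symm
    rw [Complex.ofReal_inj.1 h1]
    refine Finset.sum_congr rfl fun c _ => ?_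
    change q c = η c.1 * lam (B.boundary.r c)
    rw [hη1 c.1 c rfl, div_mul_cancel₀ _ (hlam _).ne']

end OrientedCW

end CWKMS

end

theorem mainTheorem1 {V E F : Type*} [Fintype V] [Fintype E] [Fintype F] [Nonempty E]
    (B : CWKMS.OrientedCW V E F) :
    Dense (B.MB : Set B.CStar) ∧
    (∀ (g : V → ℝ) (lamT lam : E → ℝ) (η : F → ℝ),
      B.IsRankTwoGraphWeight g lamT lam η → CWKMS.OrientedCW.IsFaithfulData g lamT lam η →
      ∃ ψ : B.MB →ₗ[ℂ] ℂ,
        B.IsProductFormula g lamT lam η ψ ∧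
        (∀ ψ' : B.MB →ₗ[ℂ] ℂ, B.IsProductFormula g lamT lam η ψ' → ψ' = ψ) ∧
        B.IsWeight ψ ∧ B.IsGaugeInvariant ψ ∧
        ∃ σ : ℝ → (B.CStar ≃⋆ₐ[ℂ] B.CStar),
          CWKMS.IsTimeEvolution σ ∧
          (∀ t v, σ t (B.Pv v) = B.Pv v) ∧ (∀ t e, σ t (B.Pe e) = B.Pe e) ∧
          (∀ t e, σ t (B.Se e) = ((lamT e : ℂ) ^ (Complex.I * t)) • B.Se e) ∧
          (∀ t c, σ t (B.Sc c) = ((η c.1 : ℂ) ^ (Complex.I * t)) • B.Sc c) ∧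
          ∃ (Ψ : CWKMS.Weight B.CStar) (L : Ψ.finiteSpan →ₗ[ℂ] ℂ),
            B.Extends Ψ L ψ ∧ Ψ.IsKMS L σ ∧
            ∀ (z w : Circle) (a : B.CStar), 0 ≤ a → Ψ.toFun (B.gauge z w a) = Ψ.toFun a) ∧
    (∀ ψ : B.MB →ₗ[ℂ] ℂ, B.IsWeight ψ → B.IsFaithful ψ → B.IsGaugeInvariant ψ →
      (∀ c c' : B.Corner, c.1 = c'.1 →
        ψ (B.mScStar c) / ψ (B.mStarSc c) = ψ (B.mScStar c') / ψ (B.mStarSc c')) →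
      ∃ (g : V → ℝ) (lamT lam : E → ℝ) (η : F → ℝ),
        (∀ v, (g v : ℂ) = ψ (B.mPv v)) ∧
        (∀ e, (lamT e : ℂ) = ψ (B.mSeStar e) / ψ (B.mStarSe e)) ∧
        (∀ e, (lam e : ℂ) = ψ (B.mPe e)) ∧
        (∀ c : B.Corner, (η c.1 : ℂ) = ψ (B.mScStar c) / ψ (B.mStarSc c)) ∧
        B.IsRankTwoGraphWeight g lamT lam η ∧
        CWKMS.OrientedCW.IsFaithfulData g lamT lam η) := by
  refine ⟨B.dense_MB, fun g lamT lam η hw hfaith => ?_, fun ψ hψ hf _ hη =>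
    hψ.exists_rankTwo hf hη⟩
  obtain ⟨φ, hpos, hφ⟩ := CWKMS.OrientedCW.exists_hasProductValues hw
  have hT : ∀ e, 0 < lamT e := fun e => lt_of_le_of_ne (hw.1.2.1 e) (hfaith.2.1 e).symm
  have hη : ∀ f, 0 < η f := fun f => lt_of_le_of_ne (hw.2.2 f) (hfaith.2.2.2 f).symm
  have hd := hφ.dense_eigenSpan hT hη hpos
  have hform : B.IsProductFormula g lamT lam η (φ.toLinearMap.comp B.MB.subtype) :=
    fun μ ν Ω Λ h h' => hφ μ ν Ω Λ h h'
  have h1 : φ 1 ≠ 0 := by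
    have hV : (Finset.univ : Finset V).Nonempty :=
      ⟨B.skeleton.s (Classical.arbitrary E), Finset.mem_univ _⟩
    rw [hφ.map_one_eq, Complex.ofReal_ne_zero]
    refine (mul_pos (Finset.sum_pos (fun v _ => ?_) hV)
      (Finset.sum_pos (fun e _ => ?_) Finset.univ_nonempty)).ne'
    · exact lt_of_le_of_ne (hw.1.1 v) (hfaith.1 v).symm
    · exact lt_of_le_of_ne (hw.2.1.1 e) (hfaith.2.2.1 e).symm
  have hcpow : ∀ {r : ℝ}, 0 < r → ∀ t : ℝ,
      (r : ℂ) ^ (Complex.I * t) = Complex.exp (Complex.I * (Real.log r : ℝ) * t) := by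
    intro r hr t
    rw [Complex.cpow_def_of_ne_zero (Complex.ofReal_ne_zero.2 hr.ne'), Complex.ofReal_log hr.le]
    congr 1
    ring
  refine ⟨φ.toLinearMap.comp B.MB.subtype, hform,
    fun ψ' h' => CWKMS.OrientedCW.eq_of_isProductFormula hform h', fun x y hxy => ?_,
    fun z w x => ⟨⟨B.gauge z w x, B.torus_mem _ _ x.2⟩, rfl, hφ.map_torus _ _ x⟩,
    B.evolution lamT fun c => η c.1,
    ⟨B.evolution_zero _ _, B.evolution_add _ _, CWKMS.continuous_evolution hd⟩,
    B.evolution_Pv _ _, B.evolution_Pe _ _, fun t e => ?_, fun t c => ?_,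
    CWKMS.Weight.ofFunctional φ hpos, CWKMS.Weight.extension hpos,
    ⟨CWKMS.Weight.isLinearExtension hpos, fun x => ⟨CWKMS.Weight.mem_finiteSpan hpos x, rfl⟩⟩,
    CWKMS.Weight.isKMS hpos h1 (fun t a => hφ.map_torus _ _ a) hd, fun z w a _ => ?_⟩
  · change 0 ≤ φ (y : B.CStar)
    rw [hxy]
    exact hpos x
  · rw [hcpow (hT e), B.evolution_Se]
  · rw [hcpow (hη c.1), B.evolution_Sc]
  · exact congrArg (fun z : ℂ => ENNReal.ofReal z.re) (hφ.map_torus _ _ a)
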